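/- Let $b\in\mathbb R$, let $\varphi(\xi)=e^{-|\xi|}$ and $\varphi'(\xi)=-\operatorname{sgn}(\xi)e^{-|\xi|}$ for $\xi\in\mathbb R$, and let $*$ denote convolution on $\mathbb R$. In the complex Hilbert space $L^2(\mathbb R)$ consider the linear operator $$ Lv=(1-\varphi)\,v'+(2-b)\,\varphi' v+Q(v),\qquad Q(v)=\tfrac12(b-3)\,\varphi*(\varphi' v)-\tfrac12(2b-3)\,\varphi'*(\varphi v), $$ with domain $\operatorname{Dom}(L)=\{v\in L^2(\mathbb R):(1-\varphi)v'\in L^2(\mathbb R)\}$, where $v'$ is the distributional derivative on $\mathbb R$. Its point spectrum $\sigma_p(L)$ is the set of $\lambda\in\sigma(L)$ with $\ker(L-\lambda I)\neq\{0\}$. Then $$ \sigma_p(L)=\{0\}\cup\left\{\lambda\in\mathbb C:\ 0<|\operatorname{Re}\lambda|<\tfrac52-b\right\} $$ (so $\sigma_p(L)=\{0\}$ if $b\ge\tfrac52$). Moreover, $0$ is a double eigenvalue: its generalized eigenspace $\bigcup_{n\ge1}\ker L^n$ equals $\operatorname{span}\{\varphi,\varphi'\}$ and has dimension $2$. -/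

import Mathlib

open MeasureTheory Convolution
open scoped ENNReal ContDiff

noncomputable section

namespace Peakon

/-! ### The point spectrum of an unbounded operator -/

section Spectrum

variable {X : Type*} [NormedAddCommGroup X] [NormedSpace ℂ X]

/-- The operator `A - z I`, defined on the domain of `A`. -/
def shift (A : X →ₗ.[ℂ] X) (z : ℂ) : A.domain →ₗ[ℂ] X :=
  A.toFun - z • A.domain.subtype

/-- The resolvent set of `A`: the operator `A - z I` is injective, onto, and has a bounded
inverse. -/
def resolventSet (A : X →ₗ.[ℂ] X) : Set ℂ :=
  {z | LinearMap.ker (shift A z) = ⊥ ∧ LinearMap.range (shift A z) = ⊤ ∧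
    ∃ C : ℝ, ∀ v : A.domain, ‖(v : X)‖ ≤ C * ‖shift A z v‖}

/-- The spectrum of `A`. -/
def spectrumSet (A : X →ₗ.[ℂ] X) : Set ℂ := (resolventSet A)ᶜ

/-- The point spectrum of `A`. -/
def pointSpectrum (A : X →ₗ.[ℂ] X) : Set ℂ :=
  {z | z ∈ spectrumSet A ∧ LinearMap.ker (shift A z) ≠ ⊥}

/-- The kernel of the power `(A - z I) ^ n` of an unbounded operator, on its natural domain: `v`
belongs to the kernel of the power `n + 1` if `v` is in the domain of `A` and `(A - z I) v` belongs
to the kernel of the power `n`. -/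
def powKer (A : X →ₗ.[ℂ] X) (z : ℂ) : ℕ → Submodule ℂ X
  | 0 => ⊥
  | n + 1 => ((powKer A z n).comap (shift A z)).map A.domain.subtype

/-- The generalized eigenspace (root space) of `A` at `z`, the union of the kernels of all powers
of `A - z I`. Its dimension is the algebraic multiplicity of the eigenvalue `z`. -/
def genEigenspace (A : X →ₗ.[ℂ] X) (z : ℂ) : Submodule ℂ X := ⨆ n, powKer A z n

end Spectrum

/-! ### The peakon profile -/

/-- The complex Hilbert space of square integrable functions on the line. -/
abbrev L2 : Type := Lp ℂ 2 (volume : Measure ℝ)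

/-- The profile `φ(ξ) = exp (-|ξ|)` of the peakon. -/
def peakon (x : ℝ) : ℝ := Real.exp (-|x|)

/-- The derivative `φ'(ξ) = -sgn(ξ) exp (-|ξ|)` of the profile of the peakon. -/
def peakonDeriv (x : ℝ) : ℝ := -Real.sign x * Real.exp (-|x|)

theorem hasDerivAt_peakon {x : ℝ} (hx : x ≠ 0) : HasDerivAt peakon (peakonDeriv x) x := by
  unfold peakon peakonDeriv
  rcases lt_or_gt_of_ne hx with h | h
  · rw [Real.sign_of_neg h, mul_comm]
    simpa using! ((hasDerivAt_abs_neg h).fun_neg).exp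
  · rw [Real.sign_of_pos h, mul_comm]
    simpa using! ((hasDerivAt_abs_pos h).fun_neg).exp

theorem measurable_peakon : Measurable peakon := by unfold peakon; fun_prop

theorem measurable_peakonDeriv : Measurable peakonDeriv := by
  have h : Measurable Real.sign := by
    unfold Real.sign
    exact Measurable.ite measurableSet_Iio measurable_const
      (Measurable.ite measurableSet_Ioi measurable_const measurable_const)
  unfold peakonDeriv
  fun_prop

theorem abs_peakon_le (x : ℝ) : |peakon x| ≤ Real.exp (-|x|) := by
  simp [peakon]

theorem abs_peakonDeriv_le (x : ℝ) : |peakonDeriv x| ≤ Real.exp (-|x|) := by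
  rw [peakonDeriv, abs_mul, abs_neg, Real.abs_exp]
  rcases Real.sign_apply_eq x with h | h | h <;> simp [h, Real.exp_nonneg]

theorem memLp_exp {c : ℝ} (hc : 0 < c) :
    MemLp (fun x : ℝ => Real.exp (-(c * |x|))) 2 volume := by
  rw [memLp_two_iff_integrable_sq (by fun_prop)]
  have h : Integrable (fun x : ℝ => Real.exp (-((2 * c) * |x|))) := by
    rw [← integrableOn_univ, ← Set.Iic_union_Ioi (a := (0 : ℝ))]
    refine IntegrableOn.union ?_ ?_
    · refine (integrableOn_exp_mul_Iic (by positivity : 0 < 2 * c) 0).congr_fun (fun x hx => ?_)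
        measurableSet_Iic
      simp only [abs_of_nonpos (Set.mem_Iic.1 hx)]
      congr 1
      ring
    · refine (integrableOn_exp_mul_Ioi (by linarith : -(2 * c) < 0) 0).congr_fun (fun x hx => ?_)
        measurableSet_Ioi
      simp only [abs_of_pos (Set.mem_Ioi.1 hx)]
      congr 1
      ring
  refine h.congr (Filter.Eventually.of_forall fun x => ?_)
  simp only [← Real.exp_nat_mul]
  congr 1
  push_cast
  ring

theorem memLp_of_abs_le {a : ℝ → ℝ} (ha : Measurable a) (h : ∀ x, |a x| ≤ Real.exp (-|x|)) :
    MemLp (fun x => (a x : ℂ)) 2 volume := by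
  refine MemLp.of_le_mul (c := 1) (memLp_exp one_pos) (by fun_prop) ?_
  refine Filter.Eventually.of_forall fun x => ?_
  simpa using h x

/-- The profile `φ` as an element of the space `L2`. -/
def peakonL2 : L2 := (memLp_of_abs_le measurable_peakon abs_peakon_le).toLp _

/-- The derivative `φ'` as an element of the space `L2`. -/
def peakonDerivL2 : L2 := (memLp_of_abs_le measurable_peakonDeriv abs_peakonDeriv_le).toLp _

/-! ### The bounded parts of the linearized operator -/

theorem memLp_smul {a : ℝ → ℝ} (ha : Measurable a) (h : ∀ x, |a x| ≤ Real.exp (-|x|)) (v : L2) :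
    MemLp (fun x => a x • v x) 2 volume := by
  refine MemLp.of_le_mul (c := 1) (Lp.memLp v)
    (ha.aestronglyMeasurable.smul (Lp.aestronglyMeasurable v)) ?_
  refine Filter.Eventually.of_forall fun x => ?_
  rw [norm_smul, Real.norm_eq_abs]
  refine mul_le_mul_of_nonneg_right ((h x).trans ?_) (norm_nonneg _)
  simp

theorem norm_conv_integrand_le {a c : ℝ → ℝ} (ha : ∀ x, |a x| ≤ Real.exp (-|x|))
    (hc : ∀ x, |c x| ≤ Real.exp (-|x|)) (v : L2) (x t : ℝ) :
    ‖a (x - t) • c t • v t‖ ≤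
      Real.exp (-(1 / 2 * |x|)) * (Real.exp (-(1 / 2 * |t|)) * ‖v t‖) := by
  rw [norm_smul, norm_smul, ← mul_assoc, ← mul_assoc, Real.norm_eq_abs, Real.norm_eq_abs]
  refine mul_le_mul_of_nonneg_right ?_ (norm_nonneg _)
  refine (mul_le_mul (ha _) (hc _) (abs_nonneg _) (Real.exp_nonneg _)).trans ?_
  rw [← Real.exp_add, ← Real.exp_add]
  refine Real.exp_le_exp.2 ?_
  have h1 : |x| ≤ |x - t| + |t| := by simpa using abs_add_le (x - t) t
  have h2 := abs_nonneg (x - t)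
  linarith

theorem integrable_exp_mul (v : L2) :
    Integrable (fun t : ℝ => Real.exp (-(1 / 2 * |t|)) * ‖v t‖) :=
  (memLp_exp (by norm_num : (0 : ℝ) < 1 / 2)).integrable_mul (Lp.memLp v).norm

theorem aestronglyMeasurable_conv {a c : ℝ → ℝ} (ha : Measurable a) (hc : Measurable c) (v : L2) :
    AEStronglyMeasurable (fun p : ℝ × ℝ => a (p.1 - p.2) • c p.2 • v p.2)
      (volume.prod volume) := by
  have h1 : AEStronglyMeasurable (fun p : ℝ × ℝ => a (p.1 - p.2)) (volume.prod volume) :=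
    (ha.comp (measurable_fst.sub measurable_snd)).aestronglyMeasurable
  have h2 : AEStronglyMeasurable (fun p : ℝ × ℝ => c p.2) (volume.prod volume) :=
    (hc.comp measurable_snd).aestronglyMeasurable
  have h3 : AEStronglyMeasurable (fun p : ℝ × ℝ => v p.2) (volume.prod volume) :=
    (Lp.aestronglyMeasurable v).comp_snd
  exact h1.smul (h2.smul h3)

theorem integrable_conv {a c : ℝ → ℝ} (ha : Measurable a) (hc : Measurable c)
    (ha' : ∀ x, |a x| ≤ Real.exp (-|x|)) (hc' : ∀ x, |c x| ≤ Real.exp (-|x|)) (v : L2) (x : ℝ) :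
    Integrable (fun t : ℝ => a (x - t) • c t • v t) := by
  refine ((integrable_exp_mul v).const_mul (Real.exp (-(1 / 2 * |x|)))).mono' ?_
    (Filter.Eventually.of_forall fun t => norm_conv_integrand_le ha' hc' v x t)
  exact (ha.comp (measurable_const.sub measurable_id)).aestronglyMeasurable.smul
    (hc.aestronglyMeasurable.smul (Lp.aestronglyMeasurable v))

/-- The function `a * (c v)`, where `*` is the convolution on the line. -/
def conv (a c : ℝ → ℝ) (v : ℝ → ℂ) : ℝ → ℂ :=
  a ⋆[ContinuousLinearMap.lsmul ℝ ℝ, volume] (fun y => c y • v y)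

theorem conv_apply (a c : ℝ → ℝ) (v : ℝ → ℂ) (x : ℝ) :
    conv a c v x = ∫ t, a (x - t) • c t • v t := by
  simp [conv, convolution_eq_swap]

theorem memLp_conv {a c : ℝ → ℝ} (ha : Measurable a) (hc : Measurable c)
    (ha' : ∀ x, |a x| ≤ Real.exp (-|x|)) (hc' : ∀ x, |c x| ≤ Real.exp (-|x|)) (v : L2) :
    MemLp (conv a c v) 2 volume := by
  refine MemLp.of_le_mul (c := ∫ t, Real.exp (-(1 / 2 * |t|)) * ‖v t‖)
    (memLp_exp (by norm_num : (0 : ℝ) < 1 / 2)) ?_ (Filter.Eventually.of_forall fun x => ?_)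
  · simp only [funext (conv_apply a c v)]
    exact (aestronglyMeasurable_conv ha hc v).integral_prod_right'
  · rw [conv_apply, Real.norm_eq_abs, Real.abs_exp, mul_comm, ← integral_const_mul]
    exact norm_integral_le_of_norm_le ((integrable_exp_mul v).const_mul _)
      (Filter.Eventually.of_forall fun t => norm_conv_integrand_le ha' hc' v x t)

/-- Multiplication by a function `a` with `|a| ≤ exp (-|ξ|)`, as an operator on `L2`. -/
def mulOp (a : ℝ → ℝ) (ha : Measurable a) (h : ∀ x, |a x| ≤ Real.exp (-|x|)) : L2 →ₗ[ℂ] L2 where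
  toFun v := (memLp_smul ha h v).toLp (fun x => a x • v x)
  map_add' v w := by
    rw [← MemLp.toLp_add]
    refine MemLp.toLp_congr _ _ ?_
    filter_upwards [Lp.coeFn_add v w] with x hx
    rw [Pi.add_apply, hx, Pi.add_apply, smul_add]
  map_smul' z v := by
    rw [RingHom.id_apply, ← MemLp.toLp_const_smul]
    refine MemLp.toLp_congr _ _ ?_
    filter_upwards [Lp.coeFn_smul z v] with x hx
    simp [hx, mul_left_comm]

/-- The operator `v ↦ a * (c v)` on `L2`, where `|a|, |c| ≤ exp (-|ξ|)`. -/
def convOp (a c : ℝ → ℝ) (ha : Measurable a) (hc : Measurable c)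
    (ha' : ∀ x, |a x| ≤ Real.exp (-|x|)) (hc' : ∀ x, |c x| ≤ Real.exp (-|x|)) :
    L2 →ₗ[ℂ] L2 where
  toFun v := (memLp_conv ha hc ha' hc' v).toLp (conv a c v)
  map_add' v w := by
    rw [← MemLp.toLp_add]
    refine MemLp.toLp_congr _ _ (Filter.Eventually.of_forall fun x => ?_)
    simp only [Pi.add_apply, conv_apply]
    rw [← integral_add (integrable_conv ha hc ha' hc' v x) (integrable_conv ha hc ha' hc' w x)]
    refine integral_congr_ae ?_
    filter_upwards [Lp.coeFn_add v w] with t ht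
    rw [ht, Pi.add_apply, smul_add, smul_add]
  map_smul' z v := by
    rw [RingHom.id_apply, ← MemLp.toLp_const_smul]
    refine MemLp.toLp_congr _ _ (Filter.Eventually.of_forall fun x => ?_)
    simp only [Pi.smul_apply, conv_apply]
    rw [← integral_smul]
    refine integral_congr_ae ?_
    filter_upwards [Lp.coeFn_smul z v] with t ht
    simp [ht, mul_left_comm]

/-- The operator `Q v = (b - 3) / 2 φ * (φ' v) - (2 b - 3) / 2 φ' * (φ v)` on `L2`. -/
def Q (b : ℝ) : L2 →ₗ[ℂ] L2 :=
  (((b - 3) / 2 : ℝ) : ℂ) • convOp peakon peakonDeriv measurable_peakon measurable_peakonDeriv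
      abs_peakon_le abs_peakonDeriv_le
    - (((2 * b - 3) / 2 : ℝ) : ℂ) • convOp peakonDeriv peakon measurable_peakonDeriv
      measurable_peakon abs_peakonDeriv_le abs_peakon_le

/-! ### The linearized operator -/

/-- `g` is the product `(1 - φ) v'`, where `v'` is the distributional derivative of `v` on the
line. Since `v'` belongs to the dual of the Sobolev space `H¹`, and `1 - φ` is bounded and Lipschitz
with derivative `-φ'`, the product is defined by
`⟨(1 - φ) v', ψ⟩ = ⟨v', (1 - φ) ψ⟩ = -∫ ((1 - φ) ψ)' v = -∫ ((1 - φ) ψ' - φ' ψ) v`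
for every test function `ψ`. -/
def IsWeightedDeriv (v g : L2) : Prop :=
  ∀ ψ : ℝ → ℝ, ContDiff ℝ ∞ ψ → HasCompactSupport ψ →
    ∫ x, ψ x • g x = -∫ x, ((1 - peakon x) * deriv ψ x - peakonDeriv x * ψ x) • v x

theorem IsWeightedDeriv.unique {v g h : L2} (hg : IsWeightedDeriv v g)
    (hh : IsWeightedDeriv v h) : g = h := by
  refine Lp.ext (ae_eq_of_integral_contDiff_smul_eq
    ((Lp.memLp g).locallyIntegrable (by norm_num)) ((Lp.memLp h).locallyIntegrable (by norm_num))
    fun ψ h1 h2 => ?_)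
  rw [hg ψ h1 h2, hh ψ h1 h2]

theorem integrable_test {ψ : ℝ → ℝ} (h1 : Continuous ψ) (h2 : HasCompactSupport ψ) (g : L2) :
    Integrable (fun x => ψ x • g x) :=
  ((Lp.memLp g).locallyIntegrable (by norm_num)).integrable_smul_left_of_hasCompactSupport h1 h2

theorem integrable_test' {ψ : ℝ → ℝ} (h1 : ContDiff ℝ ∞ ψ) (h2 : HasCompactSupport ψ) (v : L2) :
    Integrable
      (fun x => ((1 - peakon x) * deriv ψ x - peakonDeriv x * ψ x) • v x) := by
  have hd : Continuous (deriv ψ) := h1.continuous_deriv (by simp)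
  have hp : Continuous peakon := by unfold peakon; fun_prop
  have e1 := integrable_test (ψ := fun x => (1 - peakon x) * deriv ψ x) (by fun_prop)
    h2.deriv.mul_left v
  have e2 := integrable_test h1.continuous h2
    (mulOp peakonDeriv measurable_peakonDeriv abs_peakonDeriv_le v)
  refine (e1.sub e2).congr ?_
  filter_upwards [(memLp_smul measurable_peakonDeriv abs_peakonDeriv_le v).coeFn_toLp] with x hx
  simp only [Pi.sub_apply, mulOp, LinearMap.coe_mk, AddHom.coe_mk, hx, sub_smul, smul_smul]
  rw [mul_comm (ψ x)]

theorem IsWeightedDeriv.add {v w g h : L2} (hg : IsWeightedDeriv v g)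
    (hh : IsWeightedDeriv w h) : IsWeightedDeriv (v + w) (g + h) := by
  intro ψ h1 h2
  have e1 : ∫ x, ψ x • (g + h) x = ∫ x, (ψ x • g x + ψ x • h x) := by
    refine integral_congr_ae ?_
    filter_upwards [Lp.coeFn_add g h] with x hx
    rw [hx, Pi.add_apply, smul_add]
  have e2 : ∫ x, ((1 - peakon x) * deriv ψ x - peakonDeriv x * ψ x) • (v + w) x
      = ∫ x, (((1 - peakon x) * deriv ψ x - peakonDeriv x * ψ x) • v x
        + ((1 - peakon x) * deriv ψ x - peakonDeriv x * ψ x) • w x) := by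
    refine integral_congr_ae ?_
    filter_upwards [Lp.coeFn_add v w] with x hx
    rw [hx, Pi.add_apply, smul_add]
  rw [e1, e2, integral_add (integrable_test h1.continuous h2 g)
    (integrable_test h1.continuous h2 h), integral_add (integrable_test' h1 h2 v)
    (integrable_test' h1 h2 w), hg ψ h1 h2, hh ψ h1 h2, neg_add]

theorem IsWeightedDeriv.smul {v g : L2} (z : ℂ) (hg : IsWeightedDeriv v g) :
    IsWeightedDeriv (z • v) (z • g) := by
  intro ψ h1 h2
  have e1 : ∫ x, ψ x • (z • g) x = ∫ x, z • (ψ x • g x) := by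
    refine integral_congr_ae ?_
    filter_upwards [Lp.coeFn_smul z g] with x hx
    rw [hx, Pi.smul_apply, smul_comm]
  have e2 : ∫ x, ((1 - peakon x) * deriv ψ x - peakonDeriv x * ψ x) • (z • v) x
      = ∫ x, z • (((1 - peakon x) * deriv ψ x - peakonDeriv x * ψ x) • v x) := by
    refine integral_congr_ae ?_
    filter_upwards [Lp.coeFn_smul z v] with x hx
    rw [hx, Pi.smul_apply, smul_comm]
  rw [e1, e2, integral_smul, integral_smul, hg ψ h1 h2, smul_neg]

theorem isWeightedDeriv_zero : IsWeightedDeriv 0 0 := by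
  intro ψ h1 h2
  have e : ∀ χ : ℝ → ℝ, ∫ x, χ x • (0 : L2) x = 0 := fun χ => by
    rw [← integral_zero ℝ ℂ (μ := volume)]
    refine integral_congr_ae ?_
    filter_upwards [Lp.coeFn_zero ℂ 2 (volume : Measure ℝ)] with x hx
    rw [hx, Pi.zero_apply, smul_zero]
  rw [e, e, neg_zero]

/-- The domain `{v ∈ L² : (1 - φ) v' ∈ L²}` of the linearized operator. -/
def dom : Submodule ℂ L2 where
  carrier := {v | ∃ g, IsWeightedDeriv v g}
  add_mem' := fun ⟨g, hg⟩ ⟨h, hh⟩ => ⟨g + h, hg.add hh⟩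
  zero_mem' := ⟨0, isWeightedDeriv_zero⟩
  smul_mem' := fun z _ ⟨g, hg⟩ => ⟨z • g, hg.smul z⟩

/-- The operator `v ↦ (1 - φ) v'` on the domain of the linearized operator. -/
def weightedDeriv : dom →ₗ[ℂ] L2 where
  toFun v := v.2.choose
  map_add' v w := (v + w).2.choose_spec.unique (v.2.choose_spec.add w.2.choose_spec)
  map_smul' z v := (z • v).2.choose_spec.unique (v.2.choose_spec.smul z)

theorem isWeightedDeriv_weightedDeriv (v : dom) : IsWeightedDeriv v (weightedDeriv v) :=
  v.2.choose_spec

/-- The linearized operator `L = (1 - φ) ∂ + (2 - b) φ' + Q` at the peakon, an unbounded operator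
in `L2`. -/
def linOp (b : ℝ) : L2 →ₗ.[ℂ] L2 where
  domain := dom
  toFun := weightedDeriv
    + (((2 - b : ℝ) : ℂ) • mulOp peakonDeriv measurable_peakonDeriv abs_peakonDeriv_le
      + Q b) ∘ₗ dom.subtype

end Peakon

end

open MeasureTheory Convolution
open scoped ENNReal ContDiff

noncomputable section

namespace Peakon

open Set Filter Topology

/-! The two half-lines decouple up to multiples of φ. For x > 0 the nonlocal term Q(v) involves the
values of v on the left only through a scalar times e^{-x}; the rest is e^{-x}∫₀ˣ v and eˣ∫ₓ^∞
e^{-2t} v (`nonlocal_of_pos`). So if Lv - zv is a multiple of φ on the right, then v solves there a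
first-order integro-differential equation with one free constant κ. A solution has a differentiable
representative, because ((1-φ)v)' = (1-φ)v' - φ'v is locally integrable.

Differentiating this equation removes the nonlocal terms: w = v'' - v satisfies (1-e^{-x})w' = (z -
b e^{-x})w, hence w = C e^{zx}(1-e^{-x})^{z-b} (`exists_hasDerivAt_of_halfLine`). If C = 0, then v''
= v and square integrability leaves only multiples of e^{-x}. If C ≠ 0, the equations express
(1-e^{-x})²w by square integrable functions; this forces Re z < 0 at infinity and Re z - b + 2 >
-1/2 at the origin. The operator L anticommutes with x ↦ -x, so the left half-line obeys the same
alternative with -z in place of z. Therefore, when z is outside the open strip with the line Re z =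
0 removed, Lv - zv ∈ span{φ, φ'} implies v ∈ span{φ, φ'} (`IsImage.mem_span`).

On this span Lφ = (2-b)φ' and Lφ' = 0, so L is nilpotent there. Outside the punctured strip the only
eigenvalue is thus 0, and induction on the power of L identifies the root space at 0.

Inside the strip with Re z < 0, variation of constants gives a square integrable f with f'' - f =
e^{zx}(1-e^{-x})^{z-b}. The residual of f in the half-line equation solves F'' = F and is square
integrable, so it is a multiple of e^{-x} and fixes κ. A combination of f and e^{-x} on the right
with eˣ on the left has three coefficients, and being an eigenfunction imposes two linear
conditions: a nonzero solution exists (`exists_eigenvector_of_re_neg`). Reflection gives Re z > 0.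
-/

/-! ### Distributional derivatives and primitives -/

theorem integral_deriv_mul_primitive {k ψ : ℝ → ℝ} (hk : LocallyIntegrable k)
    (h1 : ContDiff ℝ ∞ ψ) (h2 : HasCompactSupport ψ) :
    ∫ x, deriv ψ x * ∫ t in (0 : ℝ)..x, k t = -∫ x, ψ x * k x := by
  obtain ⟨R, hR⟩ := h2.isCompact.isBounded.subset_ball 0
  have hR' : ∀ x, x ∉ Ioo (-R) R → ψ x = 0 := fun x hx => by
    by_contra h
    exact hx (by simpa [Real.ball_eq_Ioo] using hR (subset_tsupport _ h))
  have hd' : ∀ x, x ∉ Ioo (-R) R → deriv ψ x = 0 := fun x hx => by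
    by_contra h
    exact hx (by simpa [Real.ball_eq_Ioo] using hR (support_deriv_subset h))
  -- For R ≤ 0 the ball is empty and ψ vanishes identically.
  rcases le_or_gt R 0 with hR0 | hR0
  · have hE : Ioo (-R) R = ∅ := Ioo_eq_empty (by linarith)
    have e1 : ∀ x, ψ x = 0 := fun x => hR' x (by simp [hE])
    have e2 : ∀ x, deriv ψ x = 0 := fun x => hd' x (by simp [hE])
    simp [e1, e2]
  have hint : ∀ a b, IntervalIntegrable k volume a b := fun a b => (hk.integrableOn_isCompact isCompact_uIcc).intervalIntegrable
  -- The primitive is only absolutely continuous; this suffices to integrate by parts on an interval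
  -- at whose ends ψ vanishes.
  have hac := (hint (-R) R).absolutelyContinuousOnInterval_intervalIntegral (c := 0)
    (by rw [uIcc_of_le (by linarith)]; constructor <;> linarith)
  have hacψ : AbsolutelyContinuousOnInterval ψ (-R) R :=
    (h1.of_le (by simp)).contDiffOn.absolutelyContinuousOnInterval
  have key := hacψ.integral_mul_deriv_eq_deriv_mul hac
  have hsub : ∀ f : ℝ → ℝ, (∀ x, x ∉ Ioo (-R) R → f x = 0) →
      ∫ x in (-R)..R, f x = ∫ x, f x := fun f hf => by
    refine intervalIntegral.integral_eq_integral_of_support_subset fun x hx => ?_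
    by_contra h
    exact hx (hf x fun h' => h (Ioo_subset_Ioc_self h'))
  rw [hR' R (by simp), hR' (-R) (by simp)] at key
  have e : ∫ x in (-R)..R, ψ x * deriv (fun x => ∫ v in (0 : ℝ)..x, k v) x
      = ∫ x in (-R)..R, ψ x * k x := by
    refine intervalIntegral.integral_congr_ae ?_
    filter_upwards [LocallyIntegrable.ae_hasDerivAt_integral hk] with x hx _
    rw [(hx 0).deriv]
  rw [e, hsub _ fun x hx => by simp [hR' x hx], hsub _ fun x hx => by simp [hd' x hx]] at key
  linarith

/-- Real and imaginary parts reduce this to the real case. -/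
theorem integral_deriv_smul_primitive {k : ℝ → ℂ} {ψ : ℝ → ℝ} (hk : LocallyIntegrable k)
    (h1 : ContDiff ℝ ∞ ψ) (h2 : HasCompactSupport ψ) :
    ∫ x, deriv ψ x • ∫ t in (0 : ℝ)..x, k t = -∫ x, ψ x • k x := by
  have hd : Continuous (deriv ψ) := h1.continuous_deriv (by simp)
  have hint : ∀ a b, IntervalIntegrable k volume a b := fun a b => (hk.integrableOn_isCompact isCompact_uIcc).intervalIntegrable
  have hK : Continuous fun x => ∫ t in (0 : ℝ)..x, k t :=
    intervalIntegral.continuous_primitive hint 0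
  have i1 : Integrable fun x => deriv ψ x • ∫ t in (0 : ℝ)..x, k t :=
    hK.locallyIntegrable.integrable_smul_left_of_hasCompactSupport hd h2.deriv
  have i2 : Integrable fun x => ψ x • k x :=
    hk.integrable_smul_left_of_hasCompactSupport h1.continuous h2
  have hre : LocallyIntegrable fun x => (k x).re :=
    locallyIntegrable_iff.2 fun _ hs => (hk.integrableOn_isCompact hs).re
  have him : LocallyIntegrable fun x => (k x).im :=
    locallyIntegrable_iff.2 fun _ hs => (hk.integrableOn_isCompact hs).im
  apply Complex.ext
  · have e := integral_deriv_mul_primitive hre h1 h2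
    have r1 := integral_re i1
    have r2 := integral_re i2
    simp only [RCLike.re_to_complex, Complex.smul_re] at r1 r2
    rw [Complex.neg_re, ← r1, ← r2]
    simp only [smul_eq_mul]
    rw [← e]
    congr 1; ext x; congr 1
    exact (Complex.reCLM.intervalIntegral_comp_comm (hint 0 x)).symm
  · have e := integral_deriv_mul_primitive him h1 h2
    have r1 := integral_im i1
    have r2 := integral_im i2
    simp only [RCLike.im_to_complex, Complex.smul_im] at r1 r2
    rw [Complex.neg_im, ← r1, ← r2]
    simp only [smul_eq_mul]
    rw [← e]
    congr 1; ext x; congr 1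
    exact (Complex.imCLM.intervalIntegral_comp_comm (hint 0 x)).symm

/-- The primitive from -R vanishes to the left of the support trivially, and to the right because
the total integral is zero. -/
theorem exists_testFunction_deriv_eq {η : ℝ → ℝ} (h1 : ContDiff ℝ ∞ η) (h2 : HasCompactSupport η)
    (h0 : ∫ x, η x = 0) :
    ∃ ψ : ℝ → ℝ, ContDiff ℝ ∞ ψ ∧ HasCompactSupport ψ ∧ deriv ψ = η := by
  obtain ⟨R, hR⟩ := h2.isCompact.isBounded.subset_ball 0
  have hR' : ∀ x, x ∉ Ioo (-R) R → η x = 0 := fun x hx => by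
    by_contra h
    exact hx (by simpa [Real.ball_eq_Ioo] using hR (subset_tsupport _ h))
  have hder : ∀ x, HasDerivAt (fun x => ∫ t in (-R)..x, η t) (η x) x := fun x =>
    intervalIntegral.integral_hasDerivAt_right (h1.continuous.intervalIntegrable _ _)
      (h1.continuous.stronglyMeasurableAtFilter _ _) h1.continuous.continuousAt
  have hde : deriv (fun x => ∫ t in (-R)..x, η t) = η := funext fun x => (hder x).deriv
  refine ⟨fun x => ∫ t in (-R)..x, η t, ?_, ?_, hde⟩
  · rw [contDiff_infty_iff_deriv]
    exact ⟨fun x => (hder x).differentiableAt, by rwa [hde]⟩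
  · refine HasCompactSupport.intro (isCompact_Icc (a := -R) (b := R)) fun x hx => ?_
    rcases lt_or_ge x (-R) with hxR | hxR
    · refine intervalIntegral.integral_zero_ae (Eventually.of_forall fun t ht => hR' t fun h => ?_)
      rw [uIoc_of_ge hxR.le] at ht
      linarith [h.1, ht.2]
    · have hxR2 : R < x := by
        by_contra h
        exact hx ⟨hxR, not_lt.1 h⟩
      rw [intervalIntegral.integral_eq_integral_of_support_subset, h0]
      intro t ht
      by_contra h
      refine ht (hR' t fun h' => h ⟨h'.1, ?_⟩)
      linarith [h'.2]

/-- The du Bois-Reymond lemma. For a fixed θ of integral one, χ - (∫ χ) θ is the derivative of a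
test function, so ∫ χ f = (∫ χ)(∫ θ f) for every χ, and the constant is ∫ θ f. -/
theorem ae_eq_const_of_integral_deriv_smul_eq_zero {f : ℝ → ℂ} (hf : LocallyIntegrable f)
    (h : ∀ ψ : ℝ → ℝ, ContDiff ℝ ∞ ψ → HasCompactSupport ψ → ∫ x, deriv ψ x • f x = 0) :
    ∃ c : ℂ, ∀ᵐ x, f x = c := by
  let B : ContDiffBump (0 : ℝ) := ⟨1, 2, one_pos, by norm_num⟩
  let θ : ℝ → ℝ := B.normed volume
  have t1 : ContDiff ℝ ∞ θ := B.contDiff_normed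
  have t2 : HasCompactSupport θ := B.hasCompactSupport_normed
  have t3 : ∫ x, θ x = 1 := B.integral_normed
  refine ⟨∫ x, θ x • f x, ?_⟩
  refine ae_eq_of_integral_contDiff_smul_eq hf
    (continuous_const.locallyIntegrable (f := fun _ => ∫ x, θ x • f x)) fun χ c1 c2 => ?_
  have ic : Integrable χ := c1.continuous.integrable_of_hasCompactSupport c2
  have it : Integrable θ := t1.continuous.integrable_of_hasCompactSupport t2
  obtain ⟨ψ, p1, p2, p3⟩ := exists_testFunction_deriv_eq (η := fun x => χ x - (∫ t, χ t) * θ x)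
    (c1.sub (contDiff_const.mul t1))
    (c2.sub (t2.mul_left (f := fun _ => ∫ t, χ t)))
    (by rw [integral_sub ic (it.const_mul _), integral_const_mul, t3, mul_one, sub_self])
  have e := h ψ p1 p2
  rw [p3] at e
  have e2 : ∫ x, (χ x - (∫ t, χ t) * θ x) • f x
      = (∫ x, χ x • f x) - (∫ t, χ t) • ∫ x, θ x • f x := by
    simp only [sub_smul, mul_smul]
    rw [← integral_smul]
    exact integral_sub (hf.integrable_smul_left_of_hasCompactSupport c1.continuous c2)
      ((hf.integrable_smul_left_of_hasCompactSupport t1.continuous t2).smul _)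
  rw [e2, sub_eq_zero] at e
  rw [e, integral_smul_const]

/-- A function with a locally integrable distributional derivative is almost everywhere equal to
an indefinite integral of that derivative. -/
theorem ae_eq_const_add_primitive {u k : ℝ → ℂ} (hu : LocallyIntegrable u)
    (hk : LocallyIntegrable k)
    (h : ∀ ψ : ℝ → ℝ, ContDiff ℝ ∞ ψ → HasCompactSupport ψ →
      ∫ x, deriv ψ x • u x = -∫ x, ψ x • k x) :
    ∃ c : ℂ, ∀ᵐ x, u x = c + ∫ t in (0 : ℝ)..x, k t := by
  have hK : Continuous fun x => ∫ t in (0 : ℝ)..x, k t :=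
    intervalIntegral.continuous_primitive (fun a b => (hk.integrableOn_isCompact isCompact_uIcc).intervalIntegrable) 0
  -- Subtracting the primitive of k leaves a function with zero distributional derivative.
  obtain ⟨c, hc⟩ := ae_eq_const_of_integral_deriv_smul_eq_zero
    (hu.sub hK.locallyIntegrable) fun ψ h1 h2 => by
      have hd : Continuous (deriv ψ) := h1.continuous_deriv (by simp)
      simp only [Pi.sub_apply, smul_sub]
      rw [integral_sub (hu.integrable_smul_left_of_hasCompactSupport hd h2.deriv)
        (hK.locallyIntegrable.integrable_smul_left_of_hasCompactSupport hd h2.deriv), h ψ h1 h2,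
        integral_deriv_smul_primitive hk h1 h2, sub_self]
  exact ⟨c, hc.mono fun x hx => by rw [← hx]; simp⟩

/-! ### Linear differential equations on the half-line -/

/-- The complex-valued function `exp (-x)` of a real variable. -/
def expNeg (x : ℝ) : ℂ := (Real.exp (-x) : ℝ)

/-- The complex-valued function `exp x` of a real variable. -/
def expPos (x : ℝ) : ℂ := (Real.exp x : ℝ)

theorem hasDerivAt_expNeg (x : ℝ) : HasDerivAt expNeg (-expNeg x) x := by
  have h : HasDerivAt (fun x : ℝ => Real.exp (-x)) (-Real.exp (-x)) x := by
    simpa using (hasDerivAt_neg x).exp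
  exact h.ofReal_comp.congr_deriv (Complex.ofReal_neg _)

theorem hasDerivAt_expPos (x : ℝ) : HasDerivAt expPos (expPos x) x :=
  (Real.hasDerivAt_exp x).ofReal_comp

theorem continuous_expNeg : Continuous expNeg :=
  continuous_iff_continuousAt.2 fun x => (hasDerivAt_expNeg x).continuousAt

theorem continuous_expPos : Continuous expPos :=
  continuous_iff_continuousAt.2 fun x => (hasDerivAt_expPos x).continuousAt

theorem expNeg_mul_expPos (x : ℝ) : expNeg x * expPos x = 1 := by
  rw [expNeg, expPos, ← Complex.ofReal_mul, ← Real.exp_add, neg_add_cancel, Real.exp_zero,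
    Complex.ofReal_one]

theorem norm_expNeg (x : ℝ) : ‖expNeg x‖ = Real.exp (-x) := by
  rw [expNeg, Complex.norm_real, Real.norm_eq_abs, Real.abs_exp]

theorem norm_expPos (x : ℝ) : ‖expPos x‖ = Real.exp x := by
  rw [expPos, Complex.norm_real, Real.norm_eq_abs, Real.abs_exp]

theorem one_sub_exp_pos {x : ℝ} (hx : 0 < x) : 0 < 1 - Real.exp (-x) := by
  have : Real.exp (-x) < 1 := by simpa using hx
  linarith

theorem one_sub_expNeg (x : ℝ) : 1 - expNeg x = ((1 - Real.exp (-x) : ℝ) : ℂ) := by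
  simp only [expNeg, Complex.ofReal_sub, Complex.ofReal_one]

theorem one_sub_expNeg_ne_zero {x : ℝ} (hx : 0 < x) : 1 - expNeg x ≠ 0 := by
  rw [one_sub_expNeg]
  exact_mod_cast (one_sub_exp_pos hx).ne'

theorem norm_one_sub_expNeg {x : ℝ} (hx : 0 < x) : ‖1 - expNeg x‖ = 1 - Real.exp (-x) := by
  rw [one_sub_expNeg, Complex.norm_real, Real.norm_of_nonneg (one_sub_exp_pos hx).le]

theorem exists_eq_const_of_hasDerivAt_zero {f : ℝ → ℂ} (h : ∀ x, 0 < x → HasDerivAt f 0 x) :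
    ∃ C, ∀ x, 0 < x → f x = C := by
  refine ⟨f 1, fun x hx => ?_⟩
  exact (convex_Ioi (0 : ℝ)).is_const_of_fderivWithin_eq_zero (𝕜 := ℝ)
    (fun y hy => (h y hy).differentiableAt.differentiableWithinAt)
    (fun y hy => by
      rw [fderivWithin_of_isOpen isOpen_Ioi hy]
      ext
      simp [(h y hy).deriv]) hx (mem_Ioi.2 one_pos)

theorem memLp_exp_half : MemLp (fun x : ℝ => Real.exp (-(1 / 2 * x))) 2
    (volume.restrict (Ioi 0)) := by
  refine ((memLp_exp (by norm_num : (0 : ℝ) < 1 / 2)).restrict (Ioi 0)).ae_eq ?_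
  filter_upwards [ae_restrict_mem measurableSet_Ioi] with x hx
  rw [abs_of_pos hx]

theorem memLp_expNeg : MemLp expNeg 2 (volume.restrict (Ioi 0)) := by
  refine memLp_exp_half.of_le continuous_expNeg.aestronglyMeasurable ?_
  filter_upwards [ae_restrict_mem measurableSet_Ioi] with x hx
  rw [norm_expNeg, Real.norm_eq_abs, Real.abs_exp]
  refine Real.exp_le_exp.2 ?_
  linarith [mem_Ioi.1 hx]

theorem eq_zero_of_memLp_mul_expPos {C : ℂ}
    (h : MemLp (fun x => C * expPos x) 2 (volume.restrict (Ioi 0))) : C = 0 := by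
  by_contra hC
  have h1 : MemLp (fun _ : ℝ => C) 2 (volume.restrict (Ioi 0)) := by
    refine h.of_le aestronglyMeasurable_const ?_
    filter_upwards [ae_restrict_mem measurableSet_Ioi] with x hx
    rw [norm_mul, norm_expPos]
    exact le_mul_of_one_le_right (norm_nonneg _) (Real.one_le_exp (le_of_lt hx))
  rw [memLp_const_iff two_ne_zero ENNReal.ofNat_ne_top] at h1
  simp [hC] at h1

/-- The square integrable solutions of `f'' = f` on the half-line. -/
theorem exists_eq_mul_expNeg {f f₁ : ℝ → ℂ} (h : ∀ x, 0 < x → HasDerivAt f (f₁ x) x)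
    (h1 : ∀ x, 0 < x → HasDerivAt f₁ (f x) x) (hL : MemLp f 2 (volume.restrict (Ioi 0))) :
    ∃ a, ∀ x, 0 < x → f x = a * expNeg x := by
  -- The first integrals (f' + f)e^{-x} and (f - f')eˣ yield f = (m/2)eˣ + (n/2)e^{-x}.
  obtain ⟨m, hm⟩ := exists_eq_const_of_hasDerivAt_zero
    (f := fun x => (f₁ x + f x) * expNeg x) fun x hx =>
      (((h1 x hx).fun_add (h x hx)).fun_mul (hasDerivAt_expNeg x)).congr_deriv (by ring)
  obtain ⟨n, hn⟩ := exists_eq_const_of_hasDerivAt_zero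
    (f := fun x => (f x - f₁ x) * expPos x) fun x hx =>
      (((h x hx).fun_sub (h1 x hx)).fun_mul (hasDerivAt_expPos x)).congr_deriv (by ring)
  have hf : ∀ x, 0 < x → f x = m / 2 * expPos x + n / 2 * expNeg x := fun x hx => by
    have := expNeg_mul_expPos x
    linear_combination (expPos x * hm x hx + expNeg x * hn x hx) / 2 - f x * this
  have hm0 : m / 2 = 0 := by
    refine eq_zero_of_memLp_mul_expPos ((hL.sub (memLp_expNeg.const_mul (n / 2))).ae_eq ?_)
    filter_upwards [ae_restrict_mem measurableSet_Ioi] with x hx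
    rw [Pi.sub_apply, hf x hx, add_sub_cancel_right]
  exact ⟨n / 2, fun x hx => by rw [hf x hx, hm0, zero_mul, zero_add]⟩

/-- The solution `exp (z x) (1 - exp (-x)) ^ (z - b)` of `(1 - exp (-x)) w' = (z - b exp (-x)) w`
on the half-line. -/
def profile (b : ℝ) (z : ℂ) (x : ℝ) : ℂ :=
  Complex.exp (z * x + (z - b) * (Real.log (1 - Real.exp (-x)) : ℝ))

theorem hasDerivAt_profile (b : ℝ) (z : ℂ) {x : ℝ} (hx : 0 < x) :
    HasDerivAt (profile b z) ((z - b * expNeg x) / (1 - expNeg x) * profile b z x) x := by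
  have h1 : HasDerivAt (fun x : ℝ => Real.log (1 - Real.exp (-x)))
      (Real.exp (-x) / (1 - Real.exp (-x))) x := by
    have h : HasDerivAt (fun x : ℝ => 1 - Real.exp (-x)) (Real.exp (-x)) x := by
      simpa using ((hasDerivAt_neg x).exp).const_sub 1
    exact h.log (one_sub_exp_pos hx).ne'
  have h2 : HasDerivAt (fun x : ℝ => (x : ℂ)) 1 x := by
    simpa using! (hasDerivAt_id x).ofReal_comp
  refine (((h2.const_mul z).fun_add (h1.ofReal_comp.const_mul (z - b))).cexp).congr_deriv ?_
  rw [Complex.ofReal_div, ← one_sub_expNeg, mul_comm, profile]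
  congr 1
  have := one_sub_expNeg_ne_zero hx
  change z * 1 + (z - b) * (expNeg x / (1 - expNeg x)) = _
  field_simp
  ring

theorem profile_ne_zero (b : ℝ) (z : ℂ) (x : ℝ) : profile b z x ≠ 0 := Complex.exp_ne_zero _

theorem norm_profile (b : ℝ) (z : ℂ) (x : ℝ) :
    ‖profile b z x‖ = Real.exp (z.re * x + (z.re - b) * Real.log (1 - Real.exp (-x))) := by
  rw [profile, Complex.norm_exp]
  simp

/-- The profile has no zeros and solves the same linear equation, so the quotient is constant. -/
theorem exists_eq_mul_profile {b : ℝ} {z : ℂ} {w : ℝ → ℂ}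
    (h : ∀ x, 0 < x → HasDerivAt w ((z - b * expNeg x) / (1 - expNeg x) * w x) x) :
    ∃ C, ∀ x, 0 < x → w x = C * profile b z x := by
  obtain ⟨C, hC⟩ := exists_eq_const_of_hasDerivAt_zero (f := fun x => w x / profile b z x)
    fun x hx => ((h x hx).fun_div (hasDerivAt_profile b z hx)
      (profile_ne_zero b z x)).congr_deriv (by ring)
  exact ⟨C, fun x hx => by rw [← hC x hx, div_mul_cancel₀ _ (profile_ne_zero b z x)]⟩

/-- A solution of the eigenvalue equation on the half-line, written with the antiderivatives `I` of
`f` and `J` of `-exp (-2 x) f`, satisfies a differential equation of the second order. -/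
theorem exists_hasDerivAt_of_halfLine {b : ℝ} {z κ : ℂ} {f f₁ I J : ℝ → ℂ}
    (hf : ∀ x, 0 < x → HasDerivAt f (f₁ x) x) (hI : ∀ x, 0 < x → HasDerivAt I (f x) x)
    (hJ : ∀ x, 0 < x → HasDerivAt J (-(expNeg x ^ 2 * f x)) x)
    (heq : ∀ x, 0 < x → (1 - expNeg x) * f₁ x = (z + (2 - b) * expNeg x) * f x
      - expNeg x * (κ + b / 2 * I x) + 3 * (b - 2) / 2 * (expPos x * J x)) :
    ∃ C, ∀ x, 0 < x → HasDerivAt f₁ (f x + C * profile b z x) x ∧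
      (1 - expNeg x) * (f x + C * profile b z x) = (z + (1 - b) * expNeg x) * f₁ x
        + (1 - b) * expNeg x * f x + expNeg x * (κ + b / 2 * I x)
        + 3 * (b - 2) / 2 * (expPos x * J x) := by
  -- The value that the differentiated equation assigns to f''. In the derivative of the nonlocal
  -- terms `I` and `J` reappear undifferentiated, together with local terms in f.
  let f₂ : ℝ → ℂ := fun x => ((z + (1 - b) * expNeg x) * f₁ x + (1 - b) * expNeg x * f x
      + expNeg x * (κ + b / 2 * I x) + 3 * (b - 2) / 2 * (expPos x * J x)) / (1 - expNeg x)
  have he := expNeg_mul_expPos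
  have h1 : ∀ x, 0 < x → HasDerivAt f₁ (f₂ x) x := fun x hx => by
    have hd := one_sub_expNeg_ne_zero hx
    have hfe : f₁ =ᶠ[𝓝 x] fun x => ((z + (2 - b) * expNeg x) * f x
        - expNeg x * (κ + b / 2 * I x) + 3 * (b - 2) / 2 * (expPos x * J x))
          / (1 - expNeg x) := by
      filter_upwards [Ioi_mem_nhds hx] with y hy
      rw [eq_div_iff (one_sub_expNeg_ne_zero hy), mul_comm, heq y hy]
    refine HasDerivAt.congr_of_eventuallyEq ?_ hfe
    have hE := hasDerivAt_expNeg x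
    refine (((((((hE.const_mul (2 - b : ℂ)).const_add z).fun_mul (hf x hx)).fun_sub
      (hE.fun_mul (((hI x hx).const_mul (b / 2 : ℂ)).const_add κ))).fun_add
      (((hasDerivAt_expPos x).fun_mul (hJ x hx)).const_mul (3 * (b - 2) / 2 : ℂ))).fun_div
      (hE.const_sub 1) hd)).congr_deriv ?_
    simp only [f₂]
    rw [div_eq_div_iff (pow_ne_zero 2 hd) hd]
    have h3 := he x
    have h4 := heq x hx
    linear_combination ((1 - expNeg x) * expNeg x) * h4
      - (3 * (b - 2) / 2) * expNeg x * f x * (1 - expNeg x) ^ 2 * h3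
  have h2 : ∀ x, 0 < x → (1 - expNeg x) * f₂ x = (z + (1 - b) * expNeg x) * f₁ x
      + (1 - b) * expNeg x * f x + expNeg x * (κ + b / 2 * I x)
      + 3 * (b - 2) / 2 * (expPos x * J x) := fun x hx => by
    simp only [f₂]
    rw [mul_div_cancel₀ _ (one_sub_expNeg_ne_zero hx)]
  -- A second differentiation of the equation, combined with the two previous ones, eliminates `I`
  -- and `J`: f'' - f obeys the homogeneous first-order equation of the profile.
  obtain ⟨C, hC⟩ := exists_eq_mul_profile (b := b) (z := z) (w := fun x => f₂ x - f x)
    fun x hx => by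
      have hd := one_sub_expNeg_ne_zero hx
      have hE := hasDerivAt_expNeg x
      refine HasDerivAt.congr_deriv (HasDerivAt.fun_sub
        ((((((hE.const_mul (1 - b : ℂ)).const_add z).fun_mul (h1 x hx)).fun_add
        ((hE.const_mul (1 - b : ℂ)).fun_mul (hf x hx))).fun_add
        (hE.fun_mul (((hI x hx).const_mul (b / 2 : ℂ)).const_add κ))).fun_add
        (((hasDerivAt_expPos x).fun_mul (hJ x hx)).const_mul (3 * (b - 2) / 2 : ℂ)) |>.fun_div
        (hE.const_sub 1) hd) (hf x hx)) ?_
      have h3 := he x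
      have h4 := heq x hx
      have h5 := h2 x hx
      rw [div_sub' (pow_ne_zero 2 hd), div_mul_eq_mul_div (z - b * expNeg x),
        div_eq_div_iff (pow_ne_zero 2 hd) hd]
      linear_combination (1 - expNeg x) * (-(1 - expNeg x) * h4 + expNeg x * h5
        - (3 * (b - 2) / 2) * (1 - expNeg x) * expNeg x * f x * h3)
  refine ⟨C, fun x hx => ?_⟩
  have e : f x + C * profile b z x = f₂ x := by rw [← hC x hx]; ring
  rw [e]
  exact ⟨h1 x hx, h2 x hx⟩

/-! ### Square integrability of the profile -/

theorem norm_sq_mul_profile (b : ℝ) (z : ℂ) {x : ℝ} (hx : 0 < x) :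
    ‖(1 - expNeg x) ^ 2 * profile b z x‖
      = Real.exp (z.re * x + (z.re - b + 2) * Real.log (1 - Real.exp (-x))) := by
  rw [norm_mul, norm_pow, norm_one_sub_expNeg hx, norm_profile,
    ← Real.exp_log (pow_pos (one_sub_exp_pos hx) 2), ← Real.exp_add, Real.log_pow]
  congr 1
  push_cast
  ring

theorem one_sub_exp_le_self (x : ℝ) : 1 - Real.exp (-x) ≤ x := by
  linarith [Real.add_one_le_exp (-x)]

/-- The constraints on the exponents under which `(1 - exp (-x)) ^ 2 * profile b z x` is square
integrable on the half-line. -/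
theorem re_bounds_of_memLp {b : ℝ} {z : ℂ}
    (h : MemLp (fun x => (1 - expNeg x) ^ 2 * profile b z x) 2 (volume.restrict (Ioi 0))) :
    z.re < 0 ∧ -z.re < 5 / 2 - b := by
  constructor
  -- If Re z ≥ 0 there is no decay: beyond 1 the norm is bounded below by a positive constant.
  · by_contra! hz
    have hd : 0 < 1 - Real.exp (-1) := one_sub_exp_pos one_pos
    have h1 := h.mono_measure (Measure.restrict_mono (Ioi_subset_Ioi zero_le_one) le_rfl)
    have h2 : MemLp (fun _ : ℝ =>
        Real.exp (|z.re - b + 2| * Real.log (1 - Real.exp (-1)))) 2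
        (volume.restrict (Ioi 1)) := by
      refine h1.of_le aestronglyMeasurable_const ?_
      filter_upwards [ae_restrict_mem measurableSet_Ioi] with x hx
      have hx0 : 0 < x := one_pos.trans hx
      rw [norm_sq_mul_profile b z hx0, Real.norm_eq_abs, Real.abs_exp]
      refine Real.exp_le_exp.2 ?_
      have e1 : Real.log (1 - Real.exp (-1)) ≤ Real.log (1 - Real.exp (-x)) :=
        Real.log_le_log hd (by
          have : Real.exp (-x) ≤ Real.exp (-1) := Real.exp_le_exp.2 (by linarith [mem_Ioi.1 hx])
          linarith)
      have e2 : Real.log (1 - Real.exp (-x)) ≤ 0 :=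
        Real.log_nonpos (one_sub_exp_pos hx0).le (by linarith [Real.exp_pos (-x)])
      have e3 : |z.re - b + 2| * Real.log (1 - Real.exp (-1))
          ≤ |z.re - b + 2| * Real.log (1 - Real.exp (-x)) :=
        mul_le_mul_of_nonneg_left e1 (abs_nonneg _)
      have e4 : |z.re - b + 2| * Real.log (1 - Real.exp (-x))
          ≤ (z.re - b + 2) * Real.log (1 - Real.exp (-x)) :=
        mul_le_mul_of_nonpos_right (le_abs_self _) e2
      have := mul_nonneg hz hx0.le
      linarith
    rw [memLp_const_iff two_ne_zero ENNReal.ofNat_ne_top] at h2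
    simp [Real.exp_ne_zero] at h2
  · have h1 := h.mono_measure (Measure.restrict_mono
      (Ioo_subset_Ioi_self : Ioo (0 : ℝ) 1 ⊆ Ioi 0) le_rfl)
    by_contra! hz
    -- Since 1 - e^{-x} ≤ x and this exponent is negative, the norm dominates a multiple of the
    -- power of x with the same exponent, which is not square integrable at 0.
    have hq : z.re - b + 2 ≤ -1 / 2 := by linarith
    have h2 : MemLp (fun x : ℝ => x ^ (z.re - b + 2)) 2 (volume.restrict (Ioo 0 1)) := by
      refine MemLp.of_le_mul (c := Real.exp |z.re|) h1 (by fun_prop) ?_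
      filter_upwards [ae_restrict_mem measurableSet_Ioo] with x hx
      rw [norm_sq_mul_profile b z hx.1, Real.norm_of_nonneg (Real.rpow_nonneg hx.1.le _),
        Real.rpow_def_of_pos hx.1, ← Real.exp_add]
      refine Real.exp_le_exp.2 ?_
      have e1 : Real.log (1 - Real.exp (-x)) ≤ Real.log x :=
        Real.log_le_log (one_sub_exp_pos hx.1) (one_sub_exp_le_self x)
      have e2 : (z.re - b + 2) * Real.log x
          ≤ (z.re - b + 2) * Real.log (1 - Real.exp (-x)) :=
        mul_le_mul_of_nonpos_left e1 (by linarith)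
      have e3 : -|z.re| ≤ z.re * x := by
        have := abs_mul z.re x
        have e5 : |z.re * x| ≤ |z.re| := by
          rw [this, abs_of_pos hx.1]
          exact mul_le_of_le_one_right (abs_nonneg _) hx.2.le
        exact (neg_le_neg e5).trans (neg_abs_le _)
      linarith
    rw [memLp_two_iff_integrable_sq (by fun_prop)] at h2
    have h3 : IntegrableOn (fun x : ℝ => x ^ ((z.re - b + 2) * 2)) (Ioo 0 1) := by
      refine IntegrableOn.congr_fun h2 (fun x hx => ?_) measurableSet_Ioo
      rw [← Real.rpow_natCast, ← Real.rpow_mul hx.1.le]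
      norm_num
    rw [intervalIntegral.integrableOn_Ioo_rpow_iff one_pos] at h3
    linarith

/-- The integral of `v` from `0` to `x`. -/
def primitive (v : ℝ → ℂ) (x : ℝ) : ℂ := ∫ t in (0 : ℝ)..x, v t

/-- The integral of `exp (-2 t) v` from `x` to infinity. -/
def tail (v : ℝ → ℂ) (x : ℝ) : ℂ := ∫ t in Ioi x, expNeg t ^ 2 * v t

/-! ### Primitives and weighted tails of square integrable functions -/

section HalfLine

variable {v : ℝ → ℂ}

/-- Integrals ignore null sets, so a continuous representative gives a classical derivative at every
point. -/
theorem hasDerivAt_primitive_of_ae_eq {f : ℝ → ℂ} (hv : ∀ x, 0 < x → IntervalIntegrable v volume 0 x)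
    (hvf : v =ᵐ[volume.restrict (Ioi 0)] f) (hf : ContinuousOn f (Ioi 0)) {x : ℝ} (hx : 0 < x) :
    HasDerivAt (primitive v) (f x) x := by
  have hae : ∀ y, 0 < y → v =ᵐ[volume.restrict (uIoc 0 y)] f := fun y hy => by
    rw [uIoc_of_le hy.le]
    exact ae_mono (Measure.restrict_mono Ioc_subset_Ioi_self le_rfl) hvf
  have h1 : HasDerivAt (fun y => ∫ t in (0 : ℝ)..y, f t) (f x) x :=
    intervalIntegral.integral_hasDerivAt_right ((hv x hx).congr_ae (hae x hx))
      (hf.stronglyMeasurableAtFilter isOpen_Ioi x hx) (hf.continuousAt (Ioi_mem_nhds hx))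
  refine h1.congr_of_eventuallyEq ?_
  filter_upwards [Ioi_mem_nhds hx] with y hy
  refine intervalIntegral.integral_congr_ae ?_
  exact (ae_restrict_iff' measurableSet_uIoc).1 (hae y hy)

theorem intervalIntegrable_of_memLp (hv : MemLp v 2 (volume.restrict (Ioi 0))) {x : ℝ}
    (hx : 0 < x) : IntervalIntegrable v volume 0 x := by
  rw [intervalIntegrable_iff_integrableOn_Ioc_of_le hx.le]
  exact (hv.mono_measure (Measure.restrict_mono Ioc_subset_Ioi_self le_rfl)).integrable
    (by norm_num)

theorem integrableOn_sq_mul (hv : MemLp v 2 (volume.restrict (Ioi 0))) :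
    IntegrableOn (fun t => expNeg t ^ 2 * v t) (Ioi 0) := by
  have h : MemLp (fun t => expNeg t ^ 2) 2 (volume.restrict (Ioi 0)) := by
    refine memLp_exp_half.of_le (continuous_expNeg.pow 2).aestronglyMeasurable ?_
    filter_upwards [ae_restrict_mem measurableSet_Ioi] with x hx
    rw [norm_pow, norm_expNeg, Real.norm_eq_abs, Real.abs_exp, ← Real.exp_nat_mul]
    refine Real.exp_le_exp.2 ?_
    push_cast
    linarith [mem_Ioi.1 hx]
  exact h.integrable_mul hv

theorem integrableOn_exp_mul_norm (hv : MemLp v 2 (volume.restrict (Ioi 0))) :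
    IntegrableOn (fun t => Real.exp (-(1 / 2 * t)) * ‖v t‖) (Ioi 0) :=
  memLp_exp_half.integrable_mul hv.norm

theorem tail_eq_sub (hv : MemLp v 2 (volume.restrict (Ioi 0))) {x : ℝ} (hx : 0 ≤ x) :
    tail v x = tail v 0 - ∫ t in (0 : ℝ)..x, expNeg t ^ 2 * v t := by
  have h := integrableOn_sq_mul hv
  rw [eq_sub_iff_add_eq, tail, tail, intervalIntegral.integral_of_le hx, add_comm,
    ← setIntegral_union (Ioc_disjoint_Ioi le_rfl) measurableSet_Ioi
      (h.mono_set Ioc_subset_Ioi_self) (h.mono_set (Ioi_subset_Ioi hx)),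
    Ioc_union_Ioi_eq_Ioi hx]

theorem hasDerivAt_tail_of_ae_eq {f : ℝ → ℂ} (hv : MemLp v 2 (volume.restrict (Ioi 0)))
    (hvf : v =ᵐ[volume.restrict (Ioi 0)] f) (hf : ContinuousOn f (Ioi 0)) {x : ℝ} (hx : 0 < x) :
    HasDerivAt (tail v) (-(expNeg x ^ 2 * f x)) x := by
  have h1 := hasDerivAt_primitive_of_ae_eq (v := fun t => expNeg t ^ 2 * v t)
    (f := fun t => expNeg t ^ 2 * f t)
    (fun x hx => by
      rw [intervalIntegrable_iff_integrableOn_Ioc_of_le hx.le]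
      exact (integrableOn_sq_mul hv).mono_set Ioc_subset_Ioi_self)
    (hvf.mono fun t ht => by simp only [ht])
    ((continuous_expNeg.pow 2).continuousOn.mul hf) hx
  refine (h1.const_sub (tail v 0)).congr_of_eventuallyEq ?_
  filter_upwards [Ioi_mem_nhds hx] with y hy
  exact tail_eq_sub hv (le_of_lt hy)

/-- For t ≤ x one has e^{-x} ≤ e^{-x/2} e^{-t/2}. -/
theorem norm_expNeg_mul_primitive_le (hv : MemLp v 2 (volume.restrict (Ioi 0))) {x : ℝ}
    (hx : 0 < x) : ‖expNeg x * primitive v x‖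
      ≤ (∫ t in Ioi 0, Real.exp (-(1 / 2 * t)) * ‖v t‖) * Real.exp (-(1 / 2 * x)) := by
  have hi := integrableOn_exp_mul_norm hv
  have h0 : 0 ≤ᵐ[volume.restrict (Ioi 0)] fun t => Real.exp (-(1 / 2 * t)) * ‖v t‖ :=
    Eventually.of_forall fun t => by positivity
  rw [primitive, intervalIntegral.integral_of_le hx.le, ← integral_const_mul]
  calc ‖∫ t in Ioc 0 x, expNeg x * v t‖
      ≤ ∫ t in Ioc 0 x, Real.exp (-(1 / 2 * x)) * (Real.exp (-(1 / 2 * t)) * ‖v t‖) := by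
        refine norm_integral_le_of_norm_le
          ((hi.mono_set Ioc_subset_Ioi_self).const_mul _) ?_
        filter_upwards [ae_restrict_mem measurableSet_Ioc] with t ht
        rw [norm_mul, norm_expNeg, ← mul_assoc, ← Real.exp_add]
        refine mul_le_mul_of_nonneg_right (Real.exp_le_exp.2 ?_) (norm_nonneg _)
        linarith [ht.2]
    _ = (∫ t in Ioc 0 x, Real.exp (-(1 / 2 * t)) * ‖v t‖) * Real.exp (-(1 / 2 * x)) := by
        rw [integral_const_mul, mul_comm]
    _ ≤ _ := mul_le_mul_of_nonneg_right
        (setIntegral_mono_set hi h0 Ioc_subset_Ioi_self.eventuallyLE) (Real.exp_nonneg _)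

/-- For t ≥ x one has e^{x-2t} ≤ e^{-x/2} e^{-t/2}. -/
theorem norm_expPos_mul_tail_le (hv : MemLp v 2 (volume.restrict (Ioi 0))) {x : ℝ}
    (hx : 0 < x) : ‖expPos x * tail v x‖
      ≤ (∫ t in Ioi 0, Real.exp (-(1 / 2 * t)) * ‖v t‖) * Real.exp (-(1 / 2 * x)) := by
  have hi := integrableOn_exp_mul_norm hv
  have h0 : 0 ≤ᵐ[volume.restrict (Ioi 0)] fun t => Real.exp (-(1 / 2 * t)) * ‖v t‖ :=
    Eventually.of_forall fun t => by positivity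
  have hs : Ioi x ⊆ Ioi 0 := Ioi_subset_Ioi hx.le
  rw [tail, ← integral_const_mul]
  calc ‖∫ t in Ioi x, expPos x * (expNeg t ^ 2 * v t)‖
      ≤ ∫ t in Ioi x, Real.exp (-(1 / 2 * x)) * (Real.exp (-(1 / 2 * t)) * ‖v t‖) := by
        refine norm_integral_le_of_norm_le ((hi.mono_set hs).const_mul _) ?_
        filter_upwards [ae_restrict_mem measurableSet_Ioi] with t ht
        rw [norm_mul, norm_mul, norm_pow, norm_expNeg, norm_expPos, ← mul_assoc, ← mul_assoc,
          ← Real.exp_nat_mul, ← Real.exp_add, ← Real.exp_add]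
        refine mul_le_mul_of_nonneg_right (Real.exp_le_exp.2 ?_) (norm_nonneg _)
        push_cast
        linarith [mem_Ioi.1 ht]
    _ = (∫ t in Ioi x, Real.exp (-(1 / 2 * t)) * ‖v t‖) * Real.exp (-(1 / 2 * x)) := by
        rw [integral_const_mul, mul_comm]
    _ ≤ _ := mul_le_mul_of_nonneg_right
        (setIntegral_mono_set hi h0 hs.eventuallyLE) (Real.exp_nonneg _)

theorem memLp_of_norm_le_exp_half {f : ℝ → ℂ} {M : ℝ} (hf : ContinuousOn f (Ioi 0))
    (h : ∀ x, 0 < x → ‖f x‖ ≤ M * Real.exp (-(1 / 2 * x))) :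
    MemLp f 2 (volume.restrict (Ioi 0)) := by
  refine memLp_exp_half.of_le_mul (c := M) (hf.aestronglyMeasurable measurableSet_Ioi) ?_
  filter_upwards [ae_restrict_mem measurableSet_Ioi] with x hx
  simpa using h x hx

theorem memLp_expNeg_mul_primitive {f : ℝ → ℂ} (hv : MemLp v 2 (volume.restrict (Ioi 0)))
    (hvf : v =ᵐ[volume.restrict (Ioi 0)] f) (hf : ContinuousOn f (Ioi 0)) :
    MemLp (fun x => expNeg x * primitive v x) 2 (volume.restrict (Ioi 0)) :=
  memLp_of_norm_le_exp_half (continuous_expNeg.continuousOn.mul fun _ hx =>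
    (hasDerivAt_primitive_of_ae_eq (fun _ h => intervalIntegrable_of_memLp hv h) hvf hf
      hx).continuousAt.continuousWithinAt) fun _ hx => norm_expNeg_mul_primitive_le hv hx

theorem memLp_expPos_mul_tail {f : ℝ → ℂ} (hv : MemLp v 2 (volume.restrict (Ioi 0)))
    (hvf : v =ᵐ[volume.restrict (Ioi 0)] f) (hf : ContinuousOn f (Ioi 0)) :
    MemLp (fun x => expPos x * tail v x) 2 (volume.restrict (Ioi 0)) :=
  memLp_of_norm_le_exp_half (continuous_expPos.continuousOn.mul fun _ hx =>
    (hasDerivAt_tail_of_ae_eq hv hvf hf hx).continuousAt.continuousWithinAt)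
    fun _ hx => norm_expPos_mul_tail_le hv hx

theorem memLp_bounded_mul {a f : ℝ → ℂ} {M : ℝ} (hf : MemLp f 2 (volume.restrict (Ioi 0)))
    (ha : Continuous a) (h : ∀ x, 0 < x → ‖a x‖ ≤ M) :
    MemLp (fun x => a x * f x) 2 (volume.restrict (Ioi 0)) := by
  refine hf.of_le_mul (c := M) (ha.aestronglyMeasurable.mul hf.1) ?_
  filter_upwards [ae_restrict_mem measurableSet_Ioi] with x hx
  rw [norm_mul]
  exact mul_le_mul_of_nonneg_right (h x hx) (norm_nonneg _)

theorem norm_expNeg_le_one {x : ℝ} (hx : 0 < x) : ‖expNeg x‖ ≤ 1 := by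
  rw [norm_expNeg]
  exact Real.exp_le_one_iff.2 (by linarith)

theorem memLp_expNeg_mul {f : ℝ → ℂ} (hf : MemLp f 2 (volume.restrict (Ioi 0))) :
    MemLp (fun x => expNeg x * f x) 2 (volume.restrict (Ioi 0)) :=
  memLp_bounded_mul hf continuous_expNeg fun _ hx => norm_expNeg_le_one hx

/-- A square integrable solution of the eigenvalue equation on the half-line is a multiple of
`exp (-x)`, unless the real part of the spectral parameter lies in a bounded interval. -/
theorem ae_eq_expNeg_or_re_bounds {b : ℝ} {z κ : ℂ} {f f₁ : ℝ → ℂ}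
    (hv : MemLp v 2 (volume.restrict (Ioi 0))) (hvf : v =ᵐ[volume.restrict (Ioi 0)] f)
    (hf : ∀ x, 0 < x → HasDerivAt f (f₁ x) x)
    (heq : ∀ x, 0 < x → (1 - expNeg x) * f₁ x = (z + (2 - b) * expNeg x) * f x
      - expNeg x * (κ + b / 2 * primitive v x) + 3 * (b - 2) / 2 * (expPos x * tail v x)) :
    (∃ a, v =ᵐ[volume.restrict (Ioi 0)] fun x => a * expNeg x)
      ∨ (z.re < 0 ∧ -z.re < 5 / 2 - b) := by
  have hfc : ContinuousOn f (Ioi 0) := fun x hx => (hf x hx).continuousAt.continuousWithinAt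
  have hfL : MemLp f 2 (volume.restrict (Ioi 0)) := hv.ae_eq hvf
  have hI := memLp_expNeg_mul_primitive hv hvf hfc
  have hJ := memLp_expPos_mul_tail hv hvf hfc
  obtain ⟨C, hC⟩ := exists_hasDerivAt_of_halfLine hf
    (fun x hx => hasDerivAt_primitive_of_ae_eq
      (fun _ h => intervalIntegrable_of_memLp hv h) hvf hfc hx)
    (fun x hx => hasDerivAt_tail_of_ae_eq hv hvf hfc hx) heq
  by_cases hC0 : C = 0
  · left
    obtain ⟨a, ha⟩ := exists_eq_mul_expNeg hf
      (fun x hx => by simpa [hC0] using (hC x hx).1) hfL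
    refine ⟨a, hvf.trans ?_⟩
    filter_upwards [ae_restrict_mem measurableSet_Ioi] with x hx
    exact ha x hx
  · right
    -- Only (1-e^{-x})f' is known to be square integrable, not f'. One factor 1-e^{-x} trades f''
    -- for f' through the second-order equation, the other makes f' square integrable; this is why
    -- the profile is weighted by the square.
    refine re_bounds_of_memLp ?_
    have hX : MemLp (fun x => expNeg x * (κ + b / 2 * primitive v x)) 2
        (volume.restrict (Ioi 0)) := by
      refine ((memLp_expNeg.const_mul κ).add (hI.const_mul (b / 2 : ℂ))).ae_eq
        (Eventually.of_forall fun x => ?_)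
      simp only [Pi.add_apply]
      ring
    have hY : MemLp (fun x => 3 * (b - 2) / 2 * (expPos x * tail v x)) 2
        (volume.restrict (Ioi 0)) := hJ.const_mul _
    have hG : MemLp (fun x => (z + (2 - b) * expNeg x) * f x
        - expNeg x * (κ + b / 2 * primitive v x) + 3 * (b - 2) / 2 * (expPos x * tail v x)) 2
        (volume.restrict (Ioi 0)) := by
      refine (((hfL.const_mul z).add ((memLp_expNeg_mul hfL).const_mul (2 - b : ℂ))).sub hX).add
        hY |>.ae_eq (Eventually.of_forall fun x => ?_)
      simp only [Pi.add_apply, Pi.sub_apply]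
      ring
    have hN : MemLp (fun x => (1 - b) * (expNeg x * f x)
        + expNeg x * (κ + b / 2 * primitive v x) + 3 * (b - 2) / 2 * (expPos x * tail v x)) 2
        (volume.restrict (Ioi 0)) := (((memLp_expNeg_mul hfL).const_mul (1 - b : ℂ)).add hX).add hY
    have hD : ∀ {g : ℝ → ℂ}, MemLp g 2 (volume.restrict (Ioi 0)) →
        MemLp (fun x => (1 - expNeg x) * g x) 2 (volume.restrict (Ioi 0)) := fun hg => by
      refine (hg.sub (memLp_expNeg_mul hg)).ae_eq (Eventually.of_forall fun x => ?_)
      simp only [Pi.sub_apply]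
      ring
    have hA := ((hG.const_mul z).add ((memLp_expNeg_mul hG).const_mul (1 - b : ℂ))).add (hD hN)
      |>.sub (hD (hD hfL))
    refine (hA.const_mul C⁻¹).ae_eq ?_
    filter_upwards [ae_restrict_mem measurableSet_Ioi] with x hx
    simp only [Pi.add_apply, Pi.sub_apply]
    rw [inv_mul_eq_iff_eq_mul₀ hC0, ← heq x hx]
    linear_combination -(1 - expNeg x) * (hC x hx).2

end HalfLine

/-! ### The values of the linearized operator -/

theorem peakon_of_nonneg {x : ℝ} (hx : 0 ≤ x) : peakon x = Real.exp (-x) := by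
  rw [peakon, abs_of_nonneg hx]

theorem peakonDeriv_of_pos {x : ℝ} (hx : 0 < x) : peakonDeriv x = -Real.exp (-x) := by
  rw [peakonDeriv, abs_of_pos hx, Real.sign_of_pos hx, neg_one_mul]

theorem peakon_neg (x : ℝ) : peakon (-x) = peakon x := by rw [peakon, peakon, abs_neg]

theorem peakonDeriv_neg (x : ℝ) : peakonDeriv (-x) = -peakonDeriv x := by
  rw [peakonDeriv, peakonDeriv, abs_neg, Real.sign_neg, neg_mul]

theorem one_sub_peakon_of_nonneg {x : ℝ} (hx : 0 ≤ x) :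
    ((1 - peakon x : ℝ) : ℂ) = 1 - expNeg x := by
  rw [peakon_of_nonneg hx, one_sub_expNeg]

theorem integral_eq_add_add {F : ℝ → ℂ} (hF : Integrable F) {x : ℝ} (hx : 0 < x) :
    ∫ t, F t = (∫ t in Ioi 0, F (-t)) + (∫ t in Ioo 0 x, F t) + ∫ t in Ioi x, F t := by
  rw [integral_comp_neg_Ioi, neg_zero, ← integral_Ioc_eq_integral_Ioo, add_assoc,
    ← setIntegral_union (Ioc_disjoint_Ioi le_rfl) measurableSet_Ioi hF.integrableOn
      hF.integrableOn, Ioc_union_Ioi_eq_Ioi hx.le,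
    intervalIntegral.integral_Iic_add_Ioi hF.integrableOn hF.integrableOn]

theorem primitive_eq_integral_Ioo (v : ℝ → ℂ) {x : ℝ} (hx : 0 < x) :
    primitive v x = ∫ t in Ioo 0 x, v t := by
  rw [primitive, intervalIntegral.integral_of_le hx.le, integral_Ioc_eq_integral_Ioo]

/-- On each of t < 0, 0 < t < x and t > x both exponents are linear, so the kernel is a product of
functions of x and t. For t < 0 the x-dependence is e^{-x} alone. -/
theorem conv_peakon_peakonDeriv_of_pos (v : L2) {x : ℝ} (hx : 0 < x) :
    conv peakon peakonDeriv v x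
      = expNeg x * (tail (fun t => v (-t)) 0 - primitive v x) - expPos x * tail v x := by
  rw [conv_apply, integral_eq_add_add (integrable_conv measurable_peakon measurable_peakonDeriv
    abs_peakon_le abs_peakonDeriv_le v x) hx, primitive_eq_integral_Ioo _ hx, tail, tail, mul_sub,
    sub_eq_add_neg _ (expPos x * _), sub_eq_add_neg (expNeg x * _)]
  simp only [← integral_const_mul, ← integral_neg]
  congr 1
  · congr 1
    · refine setIntegral_congr_fun measurableSet_Ioi fun t ht => ?_
      have ht : 0 < t := ht
      simp only [Complex.real_smul]
      rw [peakonDeriv_neg, peakonDeriv_of_pos ht, peakon_of_nonneg (by linarith), ← mul_assoc,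
        ← mul_assoc, expNeg, expNeg]
      congr 1
      norm_cast
      rw [neg_neg, ← Real.exp_nat_mul, ← Real.exp_add, ← Real.exp_add]
      congr 1
      push_cast
      ring
    · refine setIntegral_congr_fun measurableSet_Ioo fun t ht => ?_
      simp only [Complex.real_smul]
      rw [peakonDeriv_of_pos ht.1, peakon_of_nonneg (by linarith [ht.2]), ← mul_assoc,
        ← neg_mul, expNeg]
      congr 1
      norm_cast
      rw [mul_neg, ← Real.exp_add]
      congr 2
      ring
  · refine setIntegral_congr_fun measurableSet_Ioi fun t ht => ?_
    have ht : x < t := ht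
    simp only [Complex.real_smul]
    rw [peakonDeriv_of_pos (hx.trans ht), ← peakon_neg, peakon_of_nonneg (by linarith),
      ← mul_assoc, ← mul_assoc, ← neg_mul, expNeg, expPos]
    congr 1
    norm_cast
    rw [mul_neg, ← Real.exp_nat_mul, ← Real.exp_add, ← Real.exp_add]
    congr 2
    push_cast
    ring

theorem conv_peakonDeriv_peakon_of_pos (v : L2) {x : ℝ} (hx : 0 < x) :
    conv peakonDeriv peakon v x
      = -(expNeg x * (tail (fun t => v (-t)) 0 + primitive v x)) + expPos x * tail v x := by
  rw [conv_apply, integral_eq_add_add (integrable_conv measurable_peakonDeriv measurable_peakon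
    abs_peakonDeriv_le abs_peakon_le v x) hx, primitive_eq_integral_Ioo _ hx, tail, tail, mul_add,
    neg_add]
  simp only [← integral_const_mul, ← integral_neg]
  congr 1
  · congr 1
    · refine setIntegral_congr_fun measurableSet_Ioi fun t ht => ?_
      have ht : 0 < t := ht
      simp only [Complex.real_smul]
      rw [peakon_neg, peakonDeriv_of_pos (by linarith), peakon_of_nonneg ht.le, ← mul_assoc,
        ← mul_assoc, ← neg_mul, expNeg, expNeg]
      congr 1
      norm_cast
      rw [neg_mul, ← Real.exp_nat_mul, ← Real.exp_add, ← Real.exp_add]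
      congr 2
      push_cast
      ring
    · refine setIntegral_congr_fun measurableSet_Ioo fun t ht => ?_
      simp only [Complex.real_smul]
      rw [peakonDeriv_of_pos (by linarith [ht.2]), peakon_of_nonneg ht.1.le, ← mul_assoc,
        ← neg_mul, expNeg]
      congr 1
      norm_cast
      rw [neg_mul, ← Real.exp_add]
      congr 2
      ring
  · refine setIntegral_congr_fun measurableSet_Ioi fun t ht => ?_
    have ht : x < t := ht
    simp only [Complex.real_smul]
    rw [← neg_sub t x, peakonDeriv_neg, peakonDeriv_of_pos (by linarith),
      peakon_of_nonneg (hx.trans ht).le, ← mul_assoc, ← mul_assoc, expNeg, expPos]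
    congr 1
    norm_cast
    rw [neg_neg, ← Real.exp_nat_mul, ← Real.exp_add, ← Real.exp_add]
    congr 1
    push_cast
    ring

/-- The nonlocal part of the linearized operator as a function defined everywhere. -/
def nonlocal (b : ℝ) (v : ℝ → ℂ) (x : ℝ) : ℂ :=
  (b - 3) / 2 * conv peakon peakonDeriv v x - (2 * b - 3) / 2 * conv peakonDeriv peakon v x

theorem Q_ae_eq (b : ℝ) (v : L2) : Q b v =ᵐ[volume] nonlocal b v := by
  let p : L2 := convOp peakon peakonDeriv measurable_peakon measurable_peakonDeriv
      abs_peakon_le abs_peakonDeriv_le v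
  let q : L2 := convOp peakonDeriv peakon measurable_peakonDeriv measurable_peakon
      abs_peakonDeriv_le abs_peakon_le v
  have h1 : p =ᵐ[volume] conv peakon peakonDeriv v := (memLp_conv measurable_peakon
    measurable_peakonDeriv abs_peakon_le abs_peakonDeriv_le v).coeFn_toLp
  have h2 : q =ᵐ[volume] conv peakonDeriv peakon v := (memLp_conv measurable_peakonDeriv
    measurable_peakon abs_peakonDeriv_le abs_peakon_le v).coeFn_toLp
  have e : Q b v = (((b - 3) / 2 : ℝ) : ℂ) • p - (((2 * b - 3) / 2 : ℝ) : ℂ) • q := rfl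
  rw [e]
  filter_upwards [h1, h2, Lp.coeFn_sub ((((b - 3) / 2 : ℝ) : ℂ) • p)
    ((((2 * b - 3) / 2 : ℝ) : ℂ) • q), Lp.coeFn_smul (((b - 3) / 2 : ℝ) : ℂ) p,
    Lp.coeFn_smul (((2 * b - 3) / 2 : ℝ) : ℂ) q] with x e1 e2 e3 e4 e5
  rw [e3, Pi.sub_apply, e4, e5, Pi.smul_apply, Pi.smul_apply, e1, e2, nonlocal, smul_eq_mul,
    smul_eq_mul]
  push_cast
  rfl

/-- The decoupling of the half-lines: the values on the left contribute only a scalar multiple of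
e^{-x}. -/
theorem nonlocal_of_pos (b : ℝ) (v : L2) {x : ℝ} (hx : 0 < x) :
    nonlocal b v x = expNeg x * (3 * (b - 2) / 2 * tail (fun t => v (-t)) 0
      + b / 2 * primitive v x) - 3 * (b - 2) / 2 * (expPos x * tail v x) := by
  rw [nonlocal, conv_peakon_peakonDeriv_of_pos v hx, conv_peakonDeriv_peakon_of_pos v hx]
  ring

theorem conv_congr_ae (a c : ℝ → ℝ) {v w : ℝ → ℂ} (h : v =ᵐ[volume] w) (x : ℝ) :
    conv a c v x = conv a c w x := by
  rw [conv_apply, conv_apply]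
  refine integral_congr_ae ?_
  filter_upwards [h] with t ht
  rw [ht]

theorem nonlocal_congr_ae (b : ℝ) {v w : ℝ → ℂ} (h : v =ᵐ[volume] w) (x : ℝ) :
    nonlocal b v x = nonlocal b w x := by
  rw [nonlocal, nonlocal, conv_congr_ae _ _ h, conv_congr_ae _ _ h]

/-- Each convolution contains one even factor φ and one odd factor φ', whence the sign. -/
theorem nonlocal_comp_neg (b : ℝ) (v : ℝ → ℂ) (x : ℝ) :
    nonlocal b (fun t => v (-t)) x = -nonlocal b v (-x) := by
  have h1 : conv peakon peakonDeriv (fun t => v (-t)) x = -conv peakon peakonDeriv v (-x) := by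
    rw [conv_apply, conv_apply, ← integral_neg, ← integral_neg_eq_self]
    congr 1; ext t
    rw [peakonDeriv_neg, neg_neg, ← peakon_neg, neg_smul, smul_neg]
    congr 3
    ring
  have h2 : conv peakonDeriv peakon (fun t => v (-t)) x = -conv peakonDeriv peakon v (-x) := by
    rw [conv_apply, conv_apply, ← integral_neg, ← integral_neg_eq_self]
    congr 1; ext t
    rw [peakon_neg, neg_neg, ← neg_smul, ← peakonDeriv_neg]
    congr 2
    ring
  rw [nonlocal, nonlocal, h1, h2]
  ring

/-- `v` belongs to the domain of the linearized operator, which maps it to `u`. -/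
def IsImage (b : ℝ) (v u : L2) : Prop :=
  ∃ g, IsWeightedDeriv v g ∧ ∀ᵐ x, u x = g x + (2 - b) * peakonDeriv x * v x + nonlocal b v x

/-- The linearized operator as a linear map on its domain. -/
def linMap (b : ℝ) : dom →ₗ[ℂ] L2 :=
  weightedDeriv
    + (((2 - b : ℝ) : ℂ) • mulOp peakonDeriv measurable_peakonDeriv abs_peakonDeriv_le
      + Q b) ∘ₗ dom.subtype

theorem linMap_ae_eq (b : ℝ) (v : dom) : ∀ᵐ x, linMap b v x
    = weightedDeriv v x + (2 - b) * peakonDeriv x * (v : L2) x + nonlocal b (v : L2) x := by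
  let m : L2 := mulOp peakonDeriv measurable_peakonDeriv abs_peakonDeriv_le v
  have h1 : m =ᵐ[volume] fun x => peakonDeriv x • (v : L2) x :=
    (memLp_smul measurable_peakonDeriv abs_peakonDeriv_le (v : L2)).coeFn_toLp
  have e : linMap b v = weightedDeriv v + (((2 - b : ℝ) : ℂ) • m + Q b v) := rfl
  rw [e]
  filter_upwards [h1, Q_ae_eq b v, Lp.coeFn_add (weightedDeriv v)
    (((2 - b : ℝ) : ℂ) • m + Q b v), Lp.coeFn_add (((2 - b : ℝ) : ℂ) • m) (Q b v),
    Lp.coeFn_smul ((2 - b : ℝ) : ℂ) m] with x e1 e2 e3 e4 e5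
  rw [e3, Pi.add_apply, e4, Pi.add_apply, e5, Pi.smul_apply, e1, e2, smul_eq_mul,
    Complex.real_smul]
  push_cast
  ring

theorem isImage_linMap (b : ℝ) (v : dom) : IsImage b v (linMap b v) :=
  ⟨weightedDeriv v, isWeightedDeriv_weightedDeriv v, linMap_ae_eq b v⟩

theorem IsImage.mem_dom {b : ℝ} {v u : L2} (h : IsImage b v u) : v ∈ dom :=
  let ⟨g, hg, _⟩ := h
  ⟨g, hg⟩

theorem IsImage.linMap_eq {b : ℝ} {v u : L2} (h : IsImage b v u) (hv : v ∈ dom) :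
    linMap b ⟨v, hv⟩ = u := by
  obtain ⟨g, hg, hu⟩ := h
  have e : weightedDeriv ⟨v, hv⟩ = g := (isWeightedDeriv_weightedDeriv ⟨v, hv⟩).unique hg
  refine Lp.ext ?_
  filter_upwards [hu, linMap_ae_eq b ⟨v, hv⟩] with x h1 h2
  rw [h1, h2, e]

/-- The reflection `v(x) ↦ v(-x)`. -/
def reflect : L2 →+ L2 := Lp.compMeasurePreserving Neg.neg (Measure.measurePreserving_neg volume)

theorem reflect_ae_eq (v : L2) : ∀ᵐ x, reflect v x = v (-x) :=
  Lp.coeFn_compMeasurePreserving v _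

theorem ae_comp_neg {p : ℝ → Prop} (h : ∀ᵐ x, p x) : ∀ᵐ x, p (-x) :=
  (Measure.measurePreserving_neg (volume : Measure ℝ)).quasiMeasurePreserving.ae h

theorem IsWeightedDeriv.reflect {v g : L2} (h : IsWeightedDeriv v g) :
    IsWeightedDeriv (reflect v) (-reflect g) := by
  intro ψ h1 h2
  have e := h (fun x => ψ (-x)) (h1.comp contDiff_neg)
    (h2.comp_homeomorph (Homeomorph.neg ℝ))
  have e1 : ∫ x, ψ x • (-Peakon.reflect g : L2) x = -∫ x, ψ (-x) • g x := by
    rw [← integral_neg, ← integral_neg_eq_self]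
    refine integral_congr_ae ?_
    filter_upwards [ae_comp_neg (reflect_ae_eq g), ae_comp_neg (Lp.coeFn_neg (Peakon.reflect g))]
      with x hx hx'
    rw [hx', Pi.neg_apply, hx, neg_neg, smul_neg]
  rw [e1, e, neg_neg, ← integral_neg, ← integral_neg_eq_self]
  refine integral_congr_ae ?_
  filter_upwards [reflect_ae_eq v] with x hx
  rw [deriv_comp_neg, hx, neg_neg, peakon_neg, peakonDeriv_neg, ← neg_smul]
  congr 1
  ring

/-- The operator anticommutes with reflection, because every term is odd. This transfers results
from the right half-line to the left with the sign of the spectral parameter changed. -/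
theorem IsImage.reflect {b : ℝ} {v u : L2} (h : IsImage b v u) :
    IsImage b (reflect v) (-reflect u) := by
  obtain ⟨g, hg, hu⟩ := h
  refine ⟨-Peakon.reflect g, hg.reflect, ?_⟩
  filter_upwards [ae_comp_neg hu, reflect_ae_eq v, reflect_ae_eq g, reflect_ae_eq u,
    Lp.coeFn_neg (Peakon.reflect g), Lp.coeFn_neg (Peakon.reflect u)] with x e1 e2 e3 e4 e5 e6
  rw [e5, e6, Pi.neg_apply, Pi.neg_apply, e2, e3, e4, e1, nonlocal_congr_ae b (reflect_ae_eq v),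
    nonlocal_comp_neg, peakonDeriv_neg]
  push_cast
  ring

/-- If `L v - z v` is a multiple of the profile on the right half-line, then so is `v`, unless the
real part of `z` lies in a bounded interval. -/
theorem IsImage.ae_eq_expNeg_or_re_bounds {b : ℝ} {z η : ℂ} {v u : L2} (h : IsImage b v u)
    (hu : ∀ᵐ x ∂volume.restrict (Ioi 0), u x = z * v x + η * expNeg x) :
    (∃ a, v =ᵐ[volume.restrict (Ioi 0)] fun x => a * expNeg x)
      ∨ (z.re < 0 ∧ -z.re < 5 / 2 - b) := by
  obtain ⟨g, hg, hL⟩ := h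
  have hpc : Continuous peakon := by unfold peakon; fun_prop
  let m : L2 := mulOp peakonDeriv measurable_peakonDeriv abs_peakonDeriv_le v
  have hm : m =ᵐ[volume] fun x => peakonDeriv x • v x :=
    (memLp_smul measurable_peakonDeriv abs_peakonDeriv_le v).coeFn_toLp
  have hvl : LocallyIntegrable v := (Lp.memLp v).locallyIntegrable (by norm_num)
  have hgl : LocallyIntegrable g := (Lp.memLp g).locallyIntegrable (by norm_num)
  have hml : LocallyIntegrable m := (Lp.memLp m).locallyIntegrable (by norm_num)
  have hkl : LocallyIntegrable (fun x => g x - m x) := hgl.sub hml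
  -- By the product rule ((1-φ)v)' = g - φ'v as distributions, so (1-φ)v has a continuous
  -- representative.
  obtain ⟨c, hc⟩ := ae_eq_const_add_primitive (u := fun x => (1 - peakon x) • v x)
    (k := fun x => g x - m x)
    (locallyIntegrable_iff.2 fun K hK =>
      (hvl.integrableOn_isCompact hK).continuousOn_smul (by fun_prop) hK) hkl
    fun ψ h1 h2 => by
      have hd : Continuous (deriv ψ) := h1.continuous_deriv (by simp)
      have i1 : Integrable fun x => ψ x • g x := integrable_test h1.continuous h2 g
      have i2 : Integrable fun x => ψ x • m x := integrable_test h1.continuous h2 m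
      have i3 : Integrable fun x => ((1 - peakon x) * deriv ψ x - peakonDeriv x * ψ x) • v x :=
        integrable_test' h1 h2 v
      simp only [smul_sub]
      rw [integral_sub i1 i2, hg ψ h1 h2, neg_sub, sub_neg_eq_add, ← integral_add i2 i3]
      refine integral_congr_ae ?_
      filter_upwards [hm] with x hx
      rw [hx, smul_smul, smul_smul, ← add_smul]
      congr 1
      ring
  set U : ℝ → ℂ := fun x => c + ∫ t in (0 : ℝ)..x, (g t - m t) with hU
  have hUc : Continuous U := continuous_const.add (intervalIntegral.continuous_primitive
    (fun a b => (hkl.integrableOn_isCompact isCompact_uIcc).intervalIntegrable) 0)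
  let f : ℝ → ℂ := fun x => U x / (1 - expNeg x)
  have hfc : ContinuousOn f (Ioi 0) := hUc.continuousOn.div
    (continuous_const.sub continuous_expNeg).continuousOn fun x hx => one_sub_expNeg_ne_zero hx
  have hvf : v =ᵐ[volume.restrict (Ioi 0)] f := by
    filter_upwards [ae_restrict_mem measurableSet_Ioi, ae_restrict_of_ae hc] with x hx hx'
    rw [Complex.real_smul, one_sub_peakon_of_nonneg (le_of_lt hx)] at hx'
    rw [eq_div_iff (one_sub_expNeg_ne_zero hx), mul_comm, hx']
  have hvL : MemLp v 2 (volume.restrict (Ioi 0)) := (Lp.memLp v).restrict _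
  have hI : ∀ x, 0 < x → HasDerivAt (primitive v) (f x) x := fun x hx =>
    hasDerivAt_primitive_of_ae_eq (fun _ h => intervalIntegrable_of_memLp hvL h) hvf hfc hx
  have hJ : ∀ x, 0 < x → HasDerivAt (tail v) (-(expNeg x ^ 2 * f x)) x := fun x hx =>
    hasDerivAt_tail_of_ae_eq hvL hvf hfc hx
  let K : ℂ := tail (fun t => v (-t)) 0
  -- The equation solved for (1-φ)v'. The left half-line and η enter only through the constant in
  -- front of e^{-x}.
  let q : ℝ → ℂ := fun x => (z + (2 - b) * expNeg x) * f x
    - expNeg x * (3 * (b - 2) / 2 * K - η + b / 2 * primitive v x)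
    + 3 * (b - 2) / 2 * (expPos x * tail v x)
  have hqc : ContinuousOn q (Ioi 0) := by
    have c1 : ContinuousOn (primitive v) (Ioi 0) := fun x hx =>
      (hI x hx).continuousAt.continuousWithinAt
    have c2 : ContinuousOn (tail v) (Ioi 0) := fun x hx =>
      (hJ x hx).continuousAt.continuousWithinAt
    have c3 := continuous_expNeg
    have c4 := continuous_expPos
    simp only [q]
    fun_prop
  have hk : (fun x => g x - m x) =ᵐ[volume.restrict (Ioi 0)] fun x => q x + expNeg x * f x := by
    filter_upwards [ae_restrict_mem measurableSet_Ioi, ae_restrict_of_ae hL, hu, hvf,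
      ae_restrict_of_ae hm] with x hx e1 e2 e3 e4
    have e5 : ((peakonDeriv x : ℝ) : ℂ) = -expNeg x := by
      rw [peakonDeriv_of_pos hx, Complex.ofReal_neg, expNeg]
    rw [nonlocal_of_pos b v hx, e5, e2, e3] at e1
    rw [e4, Complex.real_smul, e5, e3]
    simp only [q, K]
    linear_combination -e1
  -- The equation makes the integrand of `U` almost everywhere equal to a continuous function, so
  -- `U` is differentiable in the classical sense, and with it f.
  have hUd : ∀ x, 0 < x → HasDerivAt U (q x + expNeg x * f x) x := fun x hx =>
    (hasDerivAt_primitive_of_ae_eq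
      (fun _ _ => (hkl.integrableOn_isCompact isCompact_uIcc).intervalIntegrable) hk
      (hqc.add (continuous_expNeg.continuousOn.mul hfc)) hx).const_add c
  refine Peakon.ae_eq_expNeg_or_re_bounds (f₁ := fun x => q x / (1 - expNeg x))
    (κ := 3 * (b - 2) / 2 * K - η) hvL hvf (fun x hx => ?_) fun x hx =>
      mul_div_cancel₀ _ (one_sub_expNeg_ne_zero hx)
  have hd := one_sub_expNeg_ne_zero hx
  refine ((hUd x hx).fun_div ((hasDerivAt_expNeg x).const_sub 1) hd).congr_deriv ?_
  have e : U x = (1 - expNeg x) * f x := (mul_div_cancel₀ _ hd).symm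
  rw [e, div_eq_div_iff (pow_ne_zero 2 hd) hd]
  ring

/-! ### A particular solution on the half-line -/

theorem norm_sub_le_of_norm_deriv_le {f f' : ℝ → ℂ} {G G' : ℝ → ℝ} {x y : ℝ} (hxy : x ≤ y)
    (hf : ∀ t ∈ Icc x y, HasDerivAt f (f' t) t) (hG : ∀ t ∈ Icc x y, HasDerivAt G (G' t) t)
    (h : ∀ t ∈ Icc x y, ‖f' t‖ ≤ G' t) : ‖f y - f x‖ ≤ G y - G x := by
  refine image_norm_le_of_norm_deriv_right_le_deriv_boundary' (a := x) (b := y)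
    (f := fun t => f t - f x) (f' := f') (B := fun t => G t - G x) (B' := G') ?_ ?_ ?_ ?_ ?_ ?_
    (right_mem_Icc.2 hxy)
  · exact fun t ht => ((hf t ht).continuousAt.sub continuousAt_const).continuousWithinAt
  · exact fun t ht => ((hf t (Ico_subset_Icc_self ht)).sub_const _).hasDerivWithinAt
  · simp
  · exact fun t ht => ((hG t ht).continuousAt.sub continuousAt_const).continuousWithinAt
  · exact fun t ht => ((hG t (Ico_subset_Icc_self ht)).sub_const _).hasDerivWithinAt
  · exact fun t ht => h t (Ico_subset_Icc_self ht)

/-- Integrate from x to 1; since p < 0, the contribution of f 1 is also dominated by the power. -/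
theorem exists_norm_le_rpow {f f' : ℝ → ℂ} {p M : ℝ} (hp : p < 0) (hM : 0 ≤ M)
    (hf : ∀ x, 0 < x → HasDerivAt f (f' x) x)
    (h : ∀ x, 0 < x → x ≤ 1 → ‖f' x‖ ≤ M * x ^ (p - 1)) :
    ∃ N, 0 ≤ N ∧ ∀ x, 0 < x → x ≤ 1 → ‖f x‖ ≤ N * x ^ p := by
  have hMp : 0 ≤ M / -p := div_nonneg hM (by linarith)
  refine ⟨‖f 1‖ + M / -p, by positivity, fun x hx hx1 => ?_⟩
  have key := norm_sub_le_of_norm_deriv_le (f := f) (f' := f') (G := fun t => M / p * t ^ p)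
    (G' := fun t => M * t ^ (p - 1)) hx1
    (fun t ht => hf t (hx.trans_le ht.1))
    (fun t ht => ((Real.hasDerivAt_rpow_const (p := p)
      (Or.inl (hx.trans_le ht.1).ne')).const_mul (M / p)).congr_deriv (by
        have := hp.ne
        field_simp))
    (fun t ht => h t (hx.trans_le ht.1) ht.2)
  have e1 : ‖f x‖ ≤ ‖f 1‖ + ‖f 1 - f x‖ := by
    have := norm_sub_norm_le (f x) (f 1)
    rw [norm_sub_rev] at this
    linarith
  have e2 : (1 : ℝ) ≤ x ^ p := Real.one_le_rpow_of_pos_of_le_one_of_nonpos hx hx1 hp.le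
  have e3 : ‖f 1‖ ≤ ‖f 1‖ * x ^ p := le_mul_of_one_le_right (norm_nonneg _) e2
  have e4 : M / p = -(M / -p) := by rw [div_neg, neg_neg]
  simp only [Real.one_rpow, e4] at key
  nlinarith

theorem memLp_of_norm_le_rpow_of_norm_le_exp {f : ℝ → ℂ} {M ρ τ : ℝ} (hρ : -1 / 2 < ρ)
    (hτ : 0 < τ) (hf : ContinuousOn f (Ioi 0))
    (h0 : ∀ x, 0 < x → x ≤ 1 → ‖f x‖ ≤ M * x ^ ρ)
    (h1 : ∀ x, 1 ≤ x → ‖f x‖ ≤ M * Real.exp (-τ * x)) :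
    MemLp f 2 (volume.restrict (Ioi 0)) := by
  have hm := hf.aestronglyMeasurable measurableSet_Ioi (μ := volume)
  rw [memLp_two_iff_integrable_sq_norm hm, ← Ioc_union_Ioi_eq_Ioi zero_le_one]
  have hm2 : AEStronglyMeasurable (fun x => ‖f x‖ ^ 2) (volume.restrict (Ioi 0)) := hm.norm.pow 2
  refine IntegrableOn.union ?_ ?_
  · have hi : IntegrableOn (fun x : ℝ => M ^ 2 * x ^ (ρ * 2)) (Ioc 0 1) :=
      ((integrableOn_Ioc_iff_integrableOn_Ioo (by simp)).2
        ((intervalIntegral.integrableOn_Ioo_rpow_iff one_pos).2 (by linarith))).const_mul _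
    refine hi.mono' (hm2.mono_measure (Measure.restrict_mono Ioc_subset_Ioi_self le_rfl)) ?_
    filter_upwards [ae_restrict_mem measurableSet_Ioc] with x hx
    have := pow_le_pow_left₀ (norm_nonneg _) (h0 x hx.1 hx.2) 2
    rw [Real.norm_of_nonneg (by positivity), Real.rpow_mul hx.1.le]
    rw [mul_pow] at this
    exact_mod_cast this
  · have hi : IntegrableOn (fun x : ℝ => M ^ 2 * Real.exp (-(2 * τ) * x)) (Ioi 1) :=
      (integrableOn_exp_mul_Ioi (by linarith) 1).const_mul _
    refine hi.mono' (hm2.mono_measure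
      (Measure.restrict_mono (Ioi_subset_Ioi zero_le_one) le_rfl)) ?_
    filter_upwards [ae_restrict_mem measurableSet_Ioi] with x hx
    have := pow_le_pow_left₀ (norm_nonneg _) (h1 x (le_of_lt hx)) 2
    rw [Real.norm_of_nonneg (by positivity)]
    rw [mul_pow, ← Real.exp_nat_mul] at this
    refine this.trans (le_of_eq ?_)
    congr 2
    push_cast
    ring

theorem exists_norm_profile_le_rpow {b ρ : ℝ} {z : ℂ} (hρ : ρ < 0) (h : ρ - 2 ≤ z.re - b) :
    ∃ M, 0 ≤ M ∧ ∀ x, 0 < x → x ≤ 1 → ‖profile b z x‖ ≤ M * x ^ (ρ - 2) := by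
  refine ⟨Real.exp (|z.re| + (2 - ρ)), Real.exp_nonneg _, fun x hx hx1 => ?_⟩
  rw [norm_profile, Real.rpow_def_of_pos hx, ← Real.exp_add]
  refine Real.exp_le_exp.2 ?_
  have e1 : Real.log (1 - Real.exp (-x)) ≤ 0 :=
    Real.log_nonpos (one_sub_exp_pos hx).le (by linarith [Real.exp_pos (-x)])
  -- That is x e^{-x} ≤ 1 - e^{-x}, or 1 + x ≤ eˣ.
  have e2 : Real.log x - x ≤ Real.log (1 - Real.exp (-x)) := by
    rw [sub_eq_add_neg, ← Real.log_exp (-x), ← Real.log_mul hx.ne' (Real.exp_ne_zero _),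
      Real.log_exp]
    refine Real.log_le_log (by positivity) ?_
    have h1 := Real.add_one_le_exp x
    have h2 := Real.exp_pos (-x)
    have h3 : Real.exp x * Real.exp (-x) = 1 := by rw [← Real.exp_add]; simp
    nlinarith
  have e3 := mul_le_mul_of_nonpos_right h e1
  have e4 := mul_le_mul_of_nonpos_left e2 (by linarith : ρ - 2 ≤ 0)
  have e5 : z.re * x ≤ |z.re| := (le_abs_self _).trans (by
    rw [abs_mul, abs_of_pos hx]
    exact mul_le_of_le_one_right (abs_nonneg _) hx1)
  nlinarith

theorem exists_norm_profile_le_exp {b τ : ℝ} {z : ℂ} (h : z.re ≤ -τ) :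
    ∃ M, 0 ≤ M ∧ ∀ x, 1 ≤ x → ‖profile b z x‖ ≤ M * Real.exp (-τ * x) := by
  have hd : 0 < 1 - Real.exp (-1) := one_sub_exp_pos one_pos
  refine ⟨Real.exp (-(|z.re - b| * Real.log (1 - Real.exp (-1)))), Real.exp_nonneg _,
    fun x hx => ?_⟩
  have hx0 : 0 < x := one_pos.trans_le hx
  rw [norm_profile, ← Real.exp_add]
  refine Real.exp_le_exp.2 ?_
  have e1 : Real.log (1 - Real.exp (-1)) ≤ Real.log (1 - Real.exp (-x)) :=
    Real.log_le_log hd (by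
      have : Real.exp (-x) ≤ Real.exp (-1) := Real.exp_le_exp.2 (by linarith)
      linarith)
  have e2 : Real.log (1 - Real.exp (-x)) ≤ 0 :=
    Real.log_nonpos (one_sub_exp_pos hx0).le (by linarith [Real.exp_pos (-x)])
  have e3 := mul_le_mul_of_nonneg_left e1 (abs_nonneg (z.re - b))
  have e4 := mul_le_mul_of_nonpos_right (neg_abs_le (z.re - b)) e2
  have e5 := mul_le_mul_of_nonneg_right h hx0.le
  linarith

/-- For spectral parameters in a strip, the inhomogeneous equation `f'' - f = profile b z` has a
solution that is square integrable on the half-line. -/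
theorem exists_hasDerivAt_memLp {b : ℝ} {z : ℂ} (hz : z.re < 0) (hb : -z.re < 5 / 2 - b) :
    ∃ f f₁ : ℝ → ℂ, (∀ x, 0 < x → HasDerivAt f (f₁ x) x) ∧
      (∀ x, 0 < x → HasDerivAt f₁ (f x + profile b z x) x) ∧
      MemLp f 2 (volume.restrict (Ioi 0)) ∧
      MemLp (fun x => (1 - expNeg x) * f₁ x) 2 (volume.restrict (Ioi 0)) ∧
      Tendsto (fun x => (1 - expNeg x) * f x) (𝓝[>] 0) (𝓝 0) := by
  -- The profile is O(x^{ρ-2}) at the origin and is integrated twice. Here ρ > -1/2 makes the result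
  -- square integrable, and ρ < 0 keeps both integrations within negative powers.
  obtain ⟨ρ, hρ1, hρ0, hρ⟩ : ∃ ρ : ℝ, -1 / 2 < ρ ∧ ρ < 0 ∧ ρ - 2 ≤ z.re - b := by
    refine ⟨min (z.re - b + 2) (-1 / 4), lt_min (by linarith) (by norm_num),
      (min_le_right _ _).trans_lt (by norm_num), ?_⟩
    linarith [min_le_left (z.re - b + 2) (-1 / 4)]
  -- A decay rate below that of e^{-x}, so that e^{-x}∫₁ˣ e^{(1-τ)t} dt is again O(e^{-τx}).
  obtain ⟨τ, hτ0, hτ1, hτ⟩ : ∃ τ : ℝ, 0 < τ ∧ τ < 1 ∧ z.re ≤ -τ := by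
    refine ⟨min (-z.re) (1 / 2), lt_min (by linarith) (by norm_num),
      (min_le_right _ _).trans_lt (by norm_num), ?_⟩
    linarith [min_le_left (-z.re) (1 / 2)]
  obtain ⟨M₀, hM₀, hg0⟩ := exists_norm_profile_le_rpow (b := b) hρ0 hρ
  obtain ⟨M₁, hM₁, hg1⟩ := exists_norm_profile_le_exp (b := b) hτ
  set g : ℝ → ℂ := profile b z with hg
  have hgc : ContinuousOn g (Ioi 0) := fun x hx =>
    (hasDerivAt_profile b z hx).continuousAt.continuousWithinAt
  have hprim : ∀ {k : ℝ → ℂ}, ContinuousOn k (Ioi 0) → ∀ x, 0 < x →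
      HasDerivAt (fun y => ∫ t in (1 : ℝ)..y, k t) (k x) x := fun {k} hk x hx =>
    intervalIntegral.integral_hasDerivAt_right
      (hk.mono fun y hy => (lt_min one_pos hx).trans_le hy.1).intervalIntegrable
      (hk.stronglyMeasurableAtFilter isOpen_Ioi x hx) (hk.continuousAt (Ioi_mem_nhds hx))
  have hkp : ContinuousOn (fun t => expPos t * g t) (Ioi 0) :=
    continuous_expPos.continuousOn.mul hgc
  have hkn : ContinuousOn (fun t => expNeg t * g t) (Ioi 0) :=
    continuous_expNeg.continuousOn.mul hgc
  have hin : IntegrableOn (fun t => expNeg t * g t) (Ioi 1) := by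
    refine ((integrableOn_exp_mul_Ioi (by linarith : -(1 + τ) < 0) 1).const_mul M₁).mono'
      ((hkn.mono (Ioi_subset_Ioi zero_le_one)).aestronglyMeasurable measurableSet_Ioi) ?_
    filter_upwards [ae_restrict_mem measurableSet_Ioi] with x hx
    rw [norm_mul, norm_expNeg]
    refine (mul_le_mul_of_nonneg_left (hg1 x (le_of_lt hx)) (Real.exp_nonneg _)).trans
      (le_of_eq ?_)
    rw [mul_left_comm, ← Real.exp_add]
    congr 2
    ring
  -- Variation of constants. The coefficient `B` of the growing solution is normalized to vanish at
  -- infinity.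
  let A : ℝ → ℂ := fun x => -(1 / 2) * ∫ t in (1 : ℝ)..x, expPos t * g t
  let B : ℝ → ℂ := fun x => 1 / 2 * (∫ t in (1 : ℝ)..x, expNeg t * g t)
    - 1 / 2 * ∫ t in Ioi 1, expNeg t * g t
  have hA : ∀ x, 0 < x → HasDerivAt A (-(1 / 2) * (expPos x * g x)) x := fun x hx =>
    (hprim hkp x hx).const_mul _
  have hB : ∀ x, 0 < x → HasDerivAt B (1 / 2 * (expNeg x * g x)) x := fun x hx =>
    ((hprim hkn x hx).const_mul _).sub_const _
  let f : ℝ → ℂ := fun x => expNeg x * A x + expPos x * B x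
  let f₁ : ℝ → ℂ := fun x => -(expNeg x * A x) + expPos x * B x
  have hf : ∀ x, 0 < x → HasDerivAt f (f₁ x) x := fun x hx => by
    refine (((hasDerivAt_expNeg x).fun_mul (hA x hx)).fun_add
      ((hasDerivAt_expPos x).fun_mul (hB x hx))).congr_deriv ?_
    simp only [f₁]
    ring
  have hf₁ : ∀ x, 0 < x → HasDerivAt f₁ (f x + g x) x := fun x hx => by
    refine ((((hasDerivAt_expNeg x).fun_mul (hA x hx)).fun_neg).fun_add
      ((hasDerivAt_expPos x).fun_mul (hB x hx))).congr_deriv ?_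
    simp only [f]
    linear_combination g x * expNeg_mul_expPos x
  have hfc : ContinuousOn f (Ioi 0) := fun x hx => (hf x hx).continuousAt.continuousWithinAt
  have hf₁c : ContinuousOn f₁ (Ioi 0) := fun x hx => (hf₁ x hx).continuousAt.continuousWithinAt
  have hle3 : ∀ {x : ℝ}, x ≤ 1 → Real.exp x ≤ 3 := fun {x} hx => by
    have := Real.exp_le_exp.2 hx
    have := Real.exp_one_lt_d9
    linarith
  obtain ⟨NA, hNA, hA0⟩ := exists_norm_le_rpow (p := ρ - 1) (M := 3 / 2 * M₀) (by linarith)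
    (by positivity) hA fun x hx hx1 => by
      rw [norm_mul, norm_mul, norm_expPos]
      have := mul_le_mul (hle3 hx1) (hg0 x hx hx1) (norm_nonneg _) (by norm_num)
      norm_num
      rw [show ρ - 1 - 1 = ρ - 2 by ring]
      linarith
  obtain ⟨NB, hNB, hB0⟩ := exists_norm_le_rpow (p := ρ - 1) (M := 3 / 2 * M₀) (by linarith)
    (by positivity) hB fun x hx hx1 => by
      rw [norm_mul, norm_mul, norm_expNeg]
      have := mul_le_mul (hle3 (by linarith : -x ≤ 1)) (hg0 x hx hx1) (norm_nonneg _)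
        (by norm_num)
      norm_num
      rw [show ρ - 1 - 1 = ρ - 2 by ring]
      linarith
  have hf₁0 : ∀ x, 0 < x → x ≤ 1 → ‖f₁ x‖ ≤ (3 * NA + 3 * NB) * x ^ (ρ - 1) :=
    fun x hx hx1 => by
      refine (norm_add_le _ _).trans ?_
      rw [norm_neg, norm_mul (expNeg x) (A x), norm_mul (expPos x) (B x), norm_expNeg, norm_expPos]
      have h1 := mul_le_mul (hle3 (by linarith : -x ≤ 1)) (hA0 x hx hx1) (norm_nonneg _)
        (by norm_num)
      have h2 := mul_le_mul (hle3 hx1) (hB0 x hx hx1) (norm_nonneg _) (by norm_num)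
      linarith
  -- Bounding f term by term as was done for f₁ would give only x^{ρ-1}; integrating the bound on f'
  -- gains the missing power.
  obtain ⟨N, hN, hf0⟩ := exists_norm_le_rpow hρ0 (by positivity) hf hf₁0
  have hAinf : ∀ x, 1 ≤ x → ‖expNeg x * A x‖ ≤ M₁ / (1 - τ) * Real.exp (-τ * x) :=
    fun x hx => by
      have key := norm_sub_le_of_norm_deriv_le (f := A)
        (f' := fun x => -(1 / 2) * (expPos x * g x))
        (G := fun t => M₁ / (1 - τ) * Real.exp ((1 - τ) * t))
        (G' := fun t => M₁ * Real.exp ((1 - τ) * t)) hx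
        (fun t ht => hA t (one_pos.trans_le ht.1))
        (fun t _ => (((((hasDerivAt_id t).const_mul (1 - τ)).exp).const_mul
          (M₁ / (1 - τ)))).congr_deriv (by
            have : 1 - τ ≠ 0 := by linarith
            simp only [id]
            field_simp))
        (fun t ht => by
          rw [norm_mul, norm_mul, norm_expPos]
          have h1 := mul_le_mul_of_nonneg_left (hg1 t ht.1) (Real.exp_nonneg t)
          have h2 : Real.exp t * (M₁ * Real.exp (-τ * t)) = M₁ * Real.exp ((1 - τ) * t) := by
            rw [mul_left_comm, ← Real.exp_add]
            congr 2
            ring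
          have h3 : 0 ≤ Real.exp t * ‖g t‖ := by positivity
          norm_num
          linarith)
      have hA1 : A 1 = 0 := by simp [A]
      rw [hA1, sub_zero] at key
      have h4 : 0 ≤ M₁ / (1 - τ) * Real.exp ((1 - τ) * 1) :=
        mul_nonneg (div_nonneg hM₁ (by linarith)) (Real.exp_nonneg _)
      have h5 : ‖A x‖ ≤ M₁ / (1 - τ) * Real.exp ((1 - τ) * x) := by linarith
      rw [norm_mul, norm_expNeg]
      refine (mul_le_mul_of_nonneg_left h5 (Real.exp_nonneg _)).trans (le_of_eq ?_)
      rw [mul_left_comm, ← Real.exp_add]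
      congr 2
      ring
  have hBinf : ∀ x, 1 ≤ x → ‖expPos x * B x‖ ≤ M₁ * Real.exp (-τ * x) := fun x hx => by
    have hBx : B x = -(1 / 2) * ∫ t in Ioi x, expNeg t * g t := by
      have : ∫ t in Ioi 1, expNeg t * g t
          = (∫ t in (1 : ℝ)..x, expNeg t * g t) + ∫ t in Ioi x, expNeg t * g t := by
        rw [intervalIntegral.integral_of_le hx,
          ← setIntegral_union (Ioc_disjoint_Ioi le_rfl) measurableSet_Ioi
          (hin.mono_set Ioc_subset_Ioi_self) (hin.mono_set (Ioi_subset_Ioi hx)),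
          Ioc_union_Ioi_eq_Ioi hx]
      simp only [B]
      rw [this]
      ring
    have h1 : ‖∫ t in Ioi x, expNeg t * g t‖
        ≤ ∫ t in Ioi x, M₁ * Real.exp (-(1 + τ) * t) := by
      refine norm_integral_le_of_norm_le
        ((integrableOn_exp_mul_Ioi (by linarith : -(1 + τ) < 0) x).const_mul M₁) ?_
      filter_upwards [ae_restrict_mem measurableSet_Ioi] with t ht
      rw [norm_mul, norm_expNeg]
      refine (mul_le_mul_of_nonneg_left (hg1 t (hx.trans (le_of_lt ht)))
        (Real.exp_nonneg _)).trans (le_of_eq ?_)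
      rw [mul_left_comm, ← Real.exp_add]
      congr 2
      ring
    rw [integral_const_mul, integral_exp_mul_Ioi (by linarith)] at h1
    have h2 : -Real.exp (-(1 + τ) * x) / -(1 + τ) ≤ Real.exp (-(1 + τ) * x) := by
      rw [neg_div_neg_eq]
      exact div_le_self (Real.exp_nonneg _) (by linarith)
    have h3 := h1.trans (mul_le_mul_of_nonneg_left h2 hM₁)
    rw [norm_mul, hBx, norm_mul, norm_expPos]
    have h4 : Real.exp x * (M₁ * Real.exp (-(1 + τ) * x)) = M₁ * Real.exp (-τ * x) := by
      rw [mul_left_comm, ← Real.exp_add]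
      congr 2
      ring
    have h5 := mul_le_mul_of_nonneg_left h3 (Real.exp_nonneg x)
    have h6 : 0 ≤ Real.exp x * ‖∫ t in Ioi x, expNeg t * g t‖ := by positivity
    have h7 : ‖(-(1 / 2) : ℂ)‖ = 1 / 2 := by norm_num
    rw [h7]
    linarith
  have hfinf : ∀ x, 1 ≤ x → ‖f x‖ ≤ (M₁ / (1 - τ) + M₁) * Real.exp (-τ * x) := fun x hx => by
    refine (norm_add_le _ _).trans ?_
    linarith [hAinf x hx, hBinf x hx]
  have hf₁inf : ∀ x, 1 ≤ x → ‖f₁ x‖ ≤ (M₁ / (1 - τ) + M₁) * Real.exp (-τ * x) :=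
    fun x hx => by
      refine (norm_add_le _ _).trans ?_
      rw [norm_neg]
      linarith [hAinf x hx, hBinf x hx]
  have hMτ : 0 ≤ M₁ / (1 - τ) + M₁ := add_nonneg (div_nonneg hM₁ (by linarith)) hM₁
  have hx_le : ∀ x, 0 < x → ‖1 - expNeg x‖ ≤ x := fun x hx => by
    rw [norm_one_sub_expNeg hx]
    exact one_sub_exp_le_self x
  refine ⟨f, f₁, hf, hf₁, ?_, ?_, ?_⟩
  · refine memLp_of_norm_le_rpow_of_norm_le_exp (M := N + (M₁ / (1 - τ) + M₁)) hρ1 hτ0 hfc ?_ ?_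
    · intro x hx hx1
      refine (hf0 x hx hx1).trans (mul_le_mul_of_nonneg_right ?_ (Real.rpow_nonneg hx.le _))
      linarith
    · intro x hx
      refine (hfinf x hx).trans (mul_le_mul_of_nonneg_right ?_ (Real.exp_nonneg _))
      linarith
  · refine memLp_of_norm_le_rpow_of_norm_le_exp
      (M := (3 * NA + 3 * NB) + (M₁ / (1 - τ) + M₁)) hρ1 hτ0
      ((continuous_const.sub continuous_expNeg).continuousOn.mul hf₁c) ?_ ?_
    · intro x hx hx1
      rw [norm_mul]
      refine (mul_le_mul (hx_le x hx) (hf₁0 x hx hx1) (norm_nonneg _) hx.le).trans ?_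
      have e : x * ((3 * NA + 3 * NB) * x ^ (ρ - 1)) = (3 * NA + 3 * NB) * x ^ ρ := by
        rw [Real.rpow_sub_one hx.ne']
        field_simp
      rw [e]
      exact mul_le_mul_of_nonneg_right (by linarith) (Real.rpow_nonneg hx.le _)
    · intro x hx
      have hx0 := one_pos.trans_le hx
      rw [norm_mul]
      have h1 : ‖1 - expNeg x‖ ≤ 1 := by
        rw [norm_one_sub_expNeg hx0]
        linarith [Real.exp_pos (-x)]
      refine (mul_le_of_le_one_left (norm_nonneg _) h1).trans ((hf₁inf x hx).trans
        (mul_le_mul_of_nonneg_right ?_ (Real.exp_nonneg _)))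
      have : 0 ≤ 3 * NA + 3 * NB := by positivity
      linarith
  · have hlim : Tendsto (fun x : ℝ => N * x ^ (ρ + 1)) (𝓝[>] 0) (𝓝 0) := by
      have h1 : ContinuousAt (fun x : ℝ => N * x ^ (ρ + 1)) 0 :=
        continuousAt_const.mul (Real.continuousAt_rpow_const _ _ (Or.inr (by linarith)))
      have h2 := h1.tendsto
      rw [Real.zero_rpow (by linarith), mul_zero] at h2
      exact h2.mono_left nhdsWithin_le_nhds
    refine squeeze_zero_norm' ?_ hlim
    filter_upwards [Ioc_mem_nhdsGT (zero_lt_one' ℝ)] with x hx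
    rw [norm_mul]
    refine (mul_le_mul (hx_le x hx.1) (hf0 x hx.1 hx.2) (norm_nonneg _) hx.1.le).trans
      (le_of_eq ?_)
    rw [Real.rpow_add_one hx.1.ne']
    ring

/-- For spectral parameters in a strip, the eigenvalue equation on the half-line has a square
integrable solution that is not a multiple of `exp (-x)`. -/
theorem exists_halfLine_solution {b : ℝ} {z : ℂ} (hz : z.re < 0) (hb : -z.re < 5 / 2 - b) :
    ∃ (f f₁ : ℝ → ℂ) (κ : ℂ), (∀ x, 0 < x → HasDerivAt f (f₁ x) x) ∧
      (∀ x, 0 < x → (1 - expNeg x) * f₁ x = (z + (2 - b) * expNeg x) * f x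
        - expNeg x * (κ + b / 2 * primitive f x) + 3 * (b - 2) / 2 * (expPos x * tail f x)) ∧
      MemLp f 2 (volume.restrict (Ioi 0)) ∧
      MemLp (fun x => (1 - expNeg x) * f₁ x) 2 (volume.restrict (Ioi 0)) ∧
      Tendsto (fun x => (1 - expNeg x) * f x) (𝓝[>] 0) (𝓝 0) ∧
      ∀ a, ∃ x, 0 < x ∧ f x ≠ a * expNeg x := by
  obtain ⟨f, f₁, hf, hf₁, hL, hL₁, h0⟩ := exists_hasDerivAt_memLp hz hb
  have hfc : ContinuousOn f (Ioi 0) := fun x hx => (hf x hx).continuousAt.continuousWithinAt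
  have hI : ∀ x, 0 < x → HasDerivAt (primitive f) (f x) x := fun x hx =>
    hasDerivAt_primitive_of_ae_eq (fun _ h => intervalIntegrable_of_memLp hL h) ae_eq_rfl hfc hx
  have hJ : ∀ x, 0 < x → HasDerivAt (tail f) (-(expNeg x ^ 2 * f x)) x := fun x hx =>
    hasDerivAt_tail_of_ae_eq hL ae_eq_rfl hfc hx
  -- The residual of the half-line equation with κ = 0. It satisfies F'' = F and is square
  -- integrable, so it equals a e^{-x}, and κ = -a cancels it.
  let F : ℝ → ℂ := fun x => (1 - expNeg x) * f₁ x - (z + (2 - b) * expNeg x) * f x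
    + b / 2 * (expNeg x * primitive f x) - 3 * (b - 2) / 2 * (expPos x * tail f x)
  let F₁ : ℝ → ℂ := fun x => expNeg x * f₁ x + (1 - expNeg x) * (f x + profile b z x)
    - (z + (2 - b) * expNeg x) * f₁ x + (2 - b) * expNeg x * f x
    - b / 2 * (expNeg x * primitive f x) + b / 2 * (expNeg x * f x)
    - 3 * (b - 2) / 2 * (expPos x * tail f x) + 3 * (b - 2) / 2 * (expNeg x * f x)
  have hF : ∀ x, 0 < x → HasDerivAt F (F₁ x) x := fun x hx => by
    have hE := hasDerivAt_expNeg x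
    refine ((((hE.const_sub 1).fun_mul (hf₁ x hx)).fun_sub
      (((hE.const_mul (2 - b : ℂ)).const_add z).fun_mul (hf x hx))).fun_add
      ((hE.fun_mul (hI x hx)).const_mul (b / 2 : ℂ))).fun_sub
      (((hasDerivAt_expPos x).fun_mul (hJ x hx)).const_mul (3 * (b - 2) / 2 : ℂ))
      |>.congr_deriv ?_
    simp only [F₁]
    linear_combination 3 * (b - 2) / 2 * expNeg x * f x * expNeg_mul_expPos x
  have hF₁ : ∀ x, 0 < x → HasDerivAt F₁ (F x) x := fun x hx => by
    have hE := hasDerivAt_expNeg x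
    have hd := one_sub_expNeg_ne_zero hx
    refine (((((((hE.fun_mul (hf₁ x hx)).fun_add ((hE.const_sub 1).fun_mul
      ((hf x hx).fun_add (hasDerivAt_profile b z hx)))).fun_sub
      (((hE.const_mul (2 - b : ℂ)).const_add z).fun_mul (hf₁ x hx))).fun_add
      ((hE.const_mul (2 - b : ℂ)).fun_mul (hf x hx))).fun_sub
      ((hE.fun_mul (hI x hx)).const_mul (b / 2 : ℂ))).fun_add
      ((hE.fun_mul (hf x hx)).const_mul (b / 2 : ℂ))).fun_sub
      (((hasDerivAt_expPos x).fun_mul (hJ x hx)).const_mul (3 * (b - 2) / 2 : ℂ))).fun_add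
      ((hE.fun_mul (hf x hx)).const_mul (3 * (b - 2) / 2 : ℂ)) |>.congr_deriv ?_
    simp only [F]
    have e : (1 - expNeg x) * ((z - b * expNeg x) / (1 - expNeg x) * profile b z x)
        = (z - b * expNeg x) * profile b z x := by
      rw [← mul_assoc, mul_div_cancel₀ _ hd]
    linear_combination e + 3 * (b - 2) / 2 * expNeg x * f x * expNeg_mul_expPos x
  have hFL : MemLp F 2 (volume.restrict (Ioi 0)) := by
    refine ((hL₁.sub ((hL.const_mul z).add ((memLp_expNeg_mul hL).const_mul (2 - b : ℂ)))).add
      ((memLp_expNeg_mul_primitive hL ae_eq_rfl hfc).const_mul (b / 2 : ℂ))).sub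
      ((memLp_expPos_mul_tail hL ae_eq_rfl hfc).const_mul (3 * (b - 2) / 2 : ℂ))
      |>.ae_eq (Eventually.of_forall fun x => ?_)
    simp only [Pi.add_apply, Pi.sub_apply, F]
    ring
  obtain ⟨a, ha⟩ := exists_eq_mul_expNeg hF hF₁ hFL
  refine ⟨f, f₁, -a, hf, fun x hx => ?_, hL, hL₁, h0, fun a' => ?_⟩
  · have := ha x hx
    simp only [F] at this
    linear_combination this
  -- A multiple of e^{-x} satisfies f'' = f, but f'' - f is the profile, which has no zeros.
  · by_contra! hc
    have h1 : ∀ x, 0 < x → f₁ x = -(a' * expNeg x) := fun x hx => by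
      refine (hf x hx).unique ?_
      have h := ((hasDerivAt_expNeg x).const_mul a').congr_of_eventuallyEq (f₁ := f)
        (by filter_upwards [Ioi_mem_nhds hx] with y hy using hc y hy)
      exact h.congr_deriv (by ring)
    have h2 : f 1 + profile b z 1 = a' * expNeg 1 := by
      refine (hf₁ 1 one_pos).unique ?_
      have h := ((hasDerivAt_expNeg 1).const_mul a').fun_neg.congr_of_eventuallyEq (f₁ := f₁)
        (by filter_upwards [Ioi_mem_nhds one_pos] with y hy using h1 y hy)
      exact h.congr_deriv (by ring)
    rw [hc 1 one_pos] at h2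
    exact profile_ne_zero b z 1 (by simpa using h2)

/-! ### Functions that are differentiable away from the peak -/

/-- The fundamental theorem on each half-line; continuity at 0 cancels the two boundary terms. -/
theorem integral_eq_zero_of_hasDerivAt {F F' : ℝ → ℂ} (hc : Continuous F)
    (hs : HasCompactSupport F) (h : ∀ x, x ≠ 0 → HasDerivAt F (F' x) x) (hi : Integrable F') :
    ∫ x, F' x = 0 := by
  have ht : Tendsto F (cocompact ℝ) (𝓝 0) := by
    rw [hasCompactSupport_iff_eventuallyEq, coclosedCompact_eq_cocompact] at hs
    exact hs.tendsto
  have h1 := integral_Ioi_of_hasDerivAt_of_tendsto hc.continuousWithinAt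
    (fun x (hx : x ∈ Ioi (0 : ℝ)) => h x (ne_of_gt hx)) hi.integrableOn
    (ht.mono_left _root_.atTop_le_cocompact)
  have h2 := integral_Iic_of_hasDerivAt_of_tendsto hc.continuousWithinAt
    (fun x (hx : x ∈ Iio (0 : ℝ)) => h x (ne_of_lt hx)) hi.integrableOn
    (ht.mono_left _root_.atBot_le_cocompact)
  rw [← intervalIntegral.integral_Iic_add_Ioi hi.integrableOn hi.integrableOn, h1, h2]
  ring

theorem continuous_peakon : Continuous peakon := by unfold peakon; fun_prop

theorem peakon_zero : peakon 0 = 1 := by simp [peakon]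

/-- A jump of v at the peak creates no point mass, because 1 - φ vanishes there: only (1-φ)v has to
be continuous. This is how φ' gets into the domain. -/
theorem isWeightedDeriv_of_hasDerivAt {v v' : ℝ → ℂ} {V G : L2} (hV : V =ᵐ[volume] v)
    (hG : G =ᵐ[volume] fun x => (1 - peakon x) • v' x)
    (h : ∀ x, x ≠ 0 → HasDerivAt v (v' x) x)
    (h0 : ContinuousAt (fun x => (1 - peakon x) • v x) 0) : IsWeightedDeriv V G := by
  intro ψ h1 h2
  have i1 : Integrable fun x => ψ x • G x := integrable_test h1.continuous h2 G
  have i2 := integrable_test' h1 h2 V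
  have hw : Continuous fun x => (1 - peakon x) • v x := by
    refine continuous_iff_continuousAt.2 fun x => ?_
    rcases eq_or_ne x 0 with rfl | hx
    · exact h0
    · exact (continuous_const.sub continuous_peakon).continuousAt.smul (h x hx).continuousAt
  rw [eq_neg_iff_add_eq_zero, ← integral_add i1 i2]
  have hae : (fun x => ψ x • G x + ((1 - peakon x) * deriv ψ x - peakonDeriv x * ψ x) • V x)
      =ᵐ[volume] fun x => ψ x • ((1 - peakon x) • v' x)
        + ((1 - peakon x) * deriv ψ x - peakonDeriv x * ψ x) • v x := by
    filter_upwards [hV, hG] with x e1 e2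
    rw [e1, e2]
  rw [integral_congr_ae hae]
  refine integral_eq_zero_of_hasDerivAt (F := fun x => ψ x • ((1 - peakon x) • v x))
    (h1.continuous.smul hw) h2.smul_right (fun x hx => ?_) ((i1.add i2).congr hae)
  have hψ : HasDerivAt ψ (deriv ψ x) x := (h1.differentiable (by simp) x).hasDerivAt
  refine (hψ.fun_smul (((hasDerivAt_peakon hx).const_sub 1).fun_smul (h x hx))).congr_deriv ?_
  simp only [Complex.real_smul]
  push_cast
  ring

/-- The function that equals `f` on the right of the origin and `a * exp x` on the left. -/
def glue (f : ℝ → ℂ) (a : ℂ) (x : ℝ) : ℂ := if 0 < x then f x else a * expPos x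

theorem glue_of_pos (f : ℝ → ℂ) (a : ℂ) {x : ℝ} (hx : 0 < x) : glue f a x = f x := if_pos hx

theorem glue_of_neg (f : ℝ → ℂ) (a : ℂ) {x : ℝ} (hx : x < 0) : glue f a x = a * expPos x :=
  if_neg (not_lt.2 hx.le)

theorem memLp_glue {f : ℝ → ℂ} (hf : MemLp f 2 (volume.restrict (Ioi 0))) (a : ℂ) :
    MemLp (glue f a) 2 volume := by
  classical
  have h : MemLp (fun x => a * expPos x) 2 (volume.restrict (Ioi 0)ᶜ) := by
    refine MemLp.const_mul (((memLp_exp one_pos).restrict _).of_le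
      continuous_expPos.aestronglyMeasurable ?_) a
    filter_upwards [ae_restrict_mem measurableSet_Ioi.compl] with x hx
    have hx : x ≤ 0 := not_lt.1 hx
    rw [norm_expPos, Real.norm_eq_abs, Real.abs_exp, abs_of_nonpos hx]
    simp
  refine (MemLp.piecewise measurableSet_Ioi hf h).ae_eq (Eventually.of_forall fun x => ?_)
  by_cases hx : 0 < x <;> simp [glue, hx]

theorem expPos_neg (x : ℝ) : expPos (-x) = expNeg x := rfl

theorem primitive_congr_ae {v w : ℝ → ℂ} (h : v =ᵐ[volume.restrict (Ioi 0)] w) {x : ℝ}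
    (hx : 0 < x) : primitive v x = primitive w x := by
  rw [primitive, primitive, intervalIntegral.integral_of_le hx.le,
    intervalIntegral.integral_of_le hx.le]
  exact integral_congr_ae (ae_mono (Measure.restrict_mono Ioc_subset_Ioi_self le_rfl) h)

theorem tail_congr_ae {v w : ℝ → ℂ} (h : v =ᵐ[volume.restrict (Ioi 0)] w) {x : ℝ}
    (hx : 0 ≤ x) : tail v x = tail w x := by
  refine integral_congr_ae ?_
  filter_upwards [ae_mono (Measure.restrict_mono (Ioi_subset_Ioi hx) le_rfl) h] with t ht
  rw [ht]

theorem primitive_add_expNeg {f : ℝ → ℂ} (hf : MemLp f 2 (volume.restrict (Ioi 0))) (s c : ℂ)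
    {x : ℝ} (hx : 0 < x) : primitive (fun x => s * f x + c * expNeg x) x
      = s * primitive f x + c * (1 - expNeg x) := by
  have h : ∫ t in (0 : ℝ)..x, expNeg t = 1 - expNeg x := by
    rw [intervalIntegral.integral_eq_sub_of_hasDerivAt (f := fun t => -expNeg t)
      (fun t _ => (hasDerivAt_expNeg t).fun_neg.congr_deriv (neg_neg _))
      (continuous_expNeg.intervalIntegrable _ _)]
    simp [expNeg]
    ring
  rw [primitive, intervalIntegral.integral_add ((intervalIntegrable_of_memLp hf hx).const_mul s)
    ((continuous_expNeg.intervalIntegrable _ _).const_mul c),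
    intervalIntegral.integral_const_mul, intervalIntegral.integral_const_mul, h, primitive]

theorem tail_add_expNeg {f : ℝ → ℂ} (hf : MemLp f 2 (volume.restrict (Ioi 0))) (s c : ℂ)
    {x : ℝ} (hx : 0 ≤ x) : tail (fun x => s * f x + c * expNeg x) x
      = s * tail f x + c * (expNeg x ^ 3 / 3) := by
  have hs : Ioi x ⊆ Ioi 0 := Ioi_subset_Ioi hx
  have hi := (integrableOn_sq_mul memLp_expNeg).mono_set hs
  have h : ∫ t in Ioi x, expNeg t ^ 2 * expNeg t = expNeg x ^ 3 / 3 := by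
    rw [integral_Ioi_of_hasDerivAt_of_tendsto' (f := fun t => -(expNeg t ^ 3 / 3)) (m := 0)
      (fun t _ => (((hasDerivAt_expNeg t).fun_pow 3).div_const 3).fun_neg.congr_deriv
        (by push_cast; ring)) hi]
    · ring
    · have h1 : Tendsto expNeg atTop (𝓝 0) := by
        have := (Complex.continuous_ofReal.tendsto 0).comp Real.tendsto_exp_neg_atTop_nhds_zero
        simpa using! this
      simpa using ((h1.pow 3).div_const 3).neg
  have e : ∀ t, expNeg t ^ 2 * (s * f t + c * expNeg t)
      = s * (expNeg t ^ 2 * f t) + c * (expNeg t ^ 2 * expNeg t) := fun t => by ring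
  simp only [tail, e]
  rw [integral_add (((integrableOn_sq_mul hf).mono_set hs).const_mul s) (hi.const_mul c),
    integral_const_mul, integral_const_mul, h]

/-- The image under the linearized operator of a function that solves the eigenvalue equation on
the right half-line up to a multiple of the profile, and is a multiple of the profile on the left
half-line. -/
theorem isImage_glue {b : ℝ} {z κ a : ℂ} {f f₁ : ℝ → ℂ} {V u : L2}
    (hf : ∀ x, 0 < x → HasDerivAt f (f₁ x) x)
    (heq : ∀ x, 0 < x → (1 - expNeg x) * f₁ x = (z + (2 - b) * expNeg x) * f x
        - expNeg x * (κ + b / 2 * primitive f x) + 3 * (b - 2) / 2 * (expPos x * tail f x))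
    (hL : MemLp (fun x => (1 - expNeg x) * f₁ x) 2 (volume.restrict (Ioi 0)))
    (h0 : Tendsto (fun x => (1 - expNeg x) * f x) (𝓝[>] 0) (𝓝 0))
    (hV : V =ᵐ[volume] glue f a)
    (hu : u =ᵐ[volume] glue (fun x => z * f x + ((b - 2) / 2 * a - κ) * expNeg x)
      ((1 - b / 2) * a - 3 * (b - 2) / 2 * tail f 0)) : IsImage b V u := by
  classical
  have hleft : MemLp (fun x => (1 - expPos x) * (a * expPos x)) 2
      (volume.restrict (Ioi 0)ᶜ) := by
    refine MemLp.of_le_mul (c := 2 * ‖a‖) ((memLp_exp one_pos).restrict _)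
      (by have := continuous_expPos; fun_prop) ?_
    filter_upwards [ae_restrict_mem measurableSet_Ioi.compl] with x hx
    have hx : x ≤ 0 := not_lt.1 hx
    have h1 : ‖1 - expPos x‖ ≤ 2 := by
      refine (norm_sub_le _ _).trans ?_
      rw [norm_one, norm_expPos]
      linarith [Real.exp_le_one_iff.2 hx]
    rw [norm_mul, norm_mul, norm_expPos, Real.norm_eq_abs, Real.abs_exp, abs_of_nonpos hx,
      mul_assoc, one_mul, neg_neg]
    exact mul_le_mul_of_nonneg_right h1 (by positivity)
  have hGL := MemLp.piecewise measurableSet_Ioi hL hleft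
  have hGae := hGL.coeFn_toLp
  set G : L2 := hGL.toLp _ with hGdef
  have hne : ∀ᵐ x : ℝ, x ≠ 0 := by
    simp [ae_iff, measure_singleton]
  have hGpos : ∀ᵐ x, 0 < x → G x = (1 - expNeg x) * f₁ x := by
    filter_upwards [hGae] with x hx h
    rw [hx, piecewise_eq_of_mem _ _ _ (mem_Ioi.2 h)]
  have hGneg : ∀ᵐ x, x < 0 → G x = (1 - expPos x) * (a * expPos x) := by
    filter_upwards [hGae] with x hx h
    rw [hx, piecewise_eq_of_notMem _ _ _ (notMem_Ioi.2 h.le)]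
  have hpk : ∀ x : ℝ, x < 0 → ((1 - peakon x : ℝ) : ℂ) = 1 - expPos x := fun x hx => by
    rw [← neg_neg x, peakon_neg, one_sub_peakon_of_nonneg (by linarith), expPos_neg]
  refine ⟨G, isWeightedDeriv_of_hasDerivAt (v := glue f a) (v' := glue f₁ a) hV ?_ ?_ ?_, ?_⟩
  · filter_upwards [hGpos, hGneg, hne] with x h1 h2 hx
    rw [Complex.real_smul]
    rcases lt_or_gt_of_ne hx with hx | hx
    · rw [h2 hx, hpk x hx, glue_of_neg _ _ hx]
    · rw [h1 hx, one_sub_peakon_of_nonneg hx.le, glue_of_pos _ _ hx]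
  · intro x hx
    rcases lt_or_gt_of_ne hx with hx | hx
    · rw [glue_of_neg _ _ hx]
      refine ((hasDerivAt_expPos x).const_mul a).congr_of_eventuallyEq ?_
      filter_upwards [Iio_mem_nhds hx] with y hy using glue_of_neg _ _ hy
    · rw [glue_of_pos _ _ hx]
      refine (hf x hx).congr_of_eventuallyEq ?_
      filter_upwards [Ioi_mem_nhds hx] with y hy using glue_of_pos _ _ hy
  · rw [continuousAt_iff_punctured_nhds, peakon_zero, sub_self, zero_smul,
      ← nhdsLT_sup_nhdsGT, tendsto_sup]
    constructor
    · have h1 : Tendsto (fun x => (1 - expPos x) * (a * expPos x)) (𝓝[<] 0) (𝓝 0) := by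
        have h2 : Continuous fun x => (1 - expPos x) * (a * expPos x) := by
          have := continuous_expPos
          fun_prop
        have h3 := h2.tendsto 0
        simp only [expPos, Real.exp_zero, Complex.ofReal_one, sub_self, zero_mul] at h3
        exact h3.mono_left nhdsWithin_le_nhds
      refine h1.congr' ?_
      filter_upwards [self_mem_nhdsWithin] with x hx
      rw [Complex.real_smul, hpk x hx, glue_of_neg _ _ hx]
    · refine h0.congr' ?_
      filter_upwards [self_mem_nhdsWithin] with x hx
      have hx : 0 < x := hx
      rw [Complex.real_smul, one_sub_peakon_of_nonneg hx.le, glue_of_pos _ _ hx]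
  · have hVp : V =ᵐ[volume.restrict (Ioi 0)] f := by
      filter_upwards [ae_restrict_of_ae hV, ae_restrict_mem measurableSet_Ioi] with x h1 h2
      rw [h1, glue_of_pos _ _ h2]
    have hVn : (fun t => V (-t)) =ᵐ[volume.restrict (Ioi 0)]
        fun x => 0 * expNeg x + a * expNeg x := by
      filter_upwards [ae_restrict_of_ae (ae_comp_neg hV), ae_restrict_mem measurableSet_Ioi]
        with x h1 h2
      have h2 : 0 < x := h2
      rw [h1, glue_of_neg _ _ (by linarith), expPos_neg, zero_mul, zero_add]
    have hR : reflect V =ᵐ[volume] fun t => V (-t) := reflect_ae_eq V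
    have hRn : reflect V =ᵐ[volume.restrict (Ioi 0)]
        fun x => 0 * expNeg x + a * expNeg x := by
      filter_upwards [hVn, ae_restrict_of_ae hR] with x h1 h2
      rw [h2, h1]
    have hRp : (fun t => reflect V (-t)) =ᵐ[volume.restrict (Ioi 0)] f := by
      filter_upwards [hVp, ae_restrict_of_ae (ae_comp_neg hR)] with x h1 h2
      rw [h2, neg_neg, h1]
    filter_upwards [hGpos, hGneg, hne, hV, hu] with x h1 h2 hx h3 h4
    rw [h3, h4]
    rcases lt_or_gt_of_ne hx with hx | hx
    · have hy : 0 < -x := by linarith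
      have e1 : ((peakonDeriv x : ℝ) : ℂ) = expNeg (-x) := by
        rw [← neg_neg x, peakonDeriv_neg, neg_neg, peakonDeriv_of_pos hy, neg_neg, expNeg]
      -- The explicit formula for the nonlocal term holds at positive points, so the left half-line
      -- is reached by reflection.
      have e2 : nonlocal b V x = -nonlocal b (reflect V) (-x) := by
        rw [nonlocal_congr_ae b hR, nonlocal_comp_neg, neg_neg, neg_neg]
      rw [h2 hx, glue_of_neg _ _ hx, glue_of_neg _ _ hx, e1, e2, nonlocal_of_pos b _ hy,
        tail_congr_ae hRp le_rfl, primitive_congr_ae hRn hy, tail_congr_ae hRn hy.le,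
        primitive_add_expNeg memLp_expNeg _ _ hy, tail_add_expNeg memLp_expNeg _ _ hy.le,
        ← neg_neg x, expPos_neg, neg_neg]
      have e3 := expNeg_mul_expPos (-x)
      linear_combination (-(b - 2) / 2 * a * expNeg (-x) ^ 2) * e3
    · have e1 : ((peakonDeriv x : ℝ) : ℂ) = -expNeg x := by
        rw [peakonDeriv_of_pos hx, Complex.ofReal_neg, expNeg]
      have e2 : expNeg 0 = 1 := by simp [expNeg]
      rw [h1 hx, glue_of_pos _ _ hx, glue_of_pos _ _ hx, e1, nonlocal_of_pos b _ hx,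
        tail_congr_ae hVn le_rfl, primitive_congr_ae hVp hx, tail_congr_ae hVp hx.le,
        tail_add_expNeg memLp_expNeg _ _ le_rfl, heq x hx, e2]
      ring

/-! ### The span of the profile and its derivative -/

theorem peakonL2_ae_eq : peakonL2 =ᵐ[volume] fun x => (peakon x : ℂ) := MemLp.coeFn_toLp _

theorem peakonDerivL2_ae_eq : peakonDerivL2 =ᵐ[volume] fun x => (peakonDeriv x : ℂ) :=
  MemLp.coeFn_toLp _

theorem ae_ne_zero : ∀ᵐ x : ℝ, x ≠ 0 := by simp [ae_iff, measure_singleton]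

/-- Since φ' = -φ on the right and φ' = φ on the left, the span consists of the functions that are a
multiple of φ on each half-line separately. -/
theorem combination_ae_eq (a c : ℂ) : (a • peakonL2 + c • peakonDerivL2 : L2)
    =ᵐ[volume] glue (fun x => (a - c) * expNeg x) (a + c) := by
  filter_upwards [peakonL2_ae_eq, peakonDerivL2_ae_eq, ae_ne_zero,
    Lp.coeFn_add (a • peakonL2) (c • peakonDerivL2), Lp.coeFn_smul a peakonL2,
    Lp.coeFn_smul c peakonDerivL2] with x e1 e2 hx e3 e4 e5
  rw [e3, Pi.add_apply, e4, e5, Pi.smul_apply, Pi.smul_apply, e1, e2, smul_eq_mul, smul_eq_mul]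
  rcases lt_or_gt_of_ne hx with hx | hx
  · have hy : 0 < -x := by linarith
    rw [glue_of_neg _ _ hx, ← neg_neg x, peakon_neg, peakonDeriv_neg, peakonDeriv_of_pos hy,
      peakon_of_nonneg hy.le, expPos_neg, expNeg]
    push_cast
    ring
  · rw [glue_of_pos _ _ hx, peakonDeriv_of_pos hx, peakon_of_nonneg hx.le, expNeg]
    push_cast
    ring

theorem ae_restrict_Ioi_of_ae_eq_glue {v : L2} {f : ℝ → ℂ} {a : ℂ}
    (h : v =ᵐ[volume] glue f a) : v =ᵐ[volume.restrict (Ioi 0)] f := by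
  filter_upwards [ae_restrict_of_ae h, ae_restrict_mem measurableSet_Ioi] with x h1 h2
  rw [h1, glue_of_pos _ _ h2]

theorem reflect_ae_restrict_Ioi_of_ae_eq_glue {v : L2} {f : ℝ → ℂ} {a : ℂ}
    (h : v =ᵐ[volume] glue f a) :
    reflect v =ᵐ[volume.restrict (Ioi 0)] fun x => a * expNeg x := by
  filter_upwards [ae_restrict_of_ae (ae_comp_neg h), ae_restrict_of_ae (reflect_ae_eq v),
    ae_restrict_mem measurableSet_Ioi] with x h1 h2 h3
  rw [h2, h1, glue_of_neg _ _ (neg_neg_iff_pos.2 h3), expPos_neg]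

theorem ae_eq_glue_of_ae_restrict {v : L2} {f : ℝ → ℂ} {a : ℂ}
    (h1 : v =ᵐ[volume.restrict (Ioi 0)] f)
    (h2 : reflect v =ᵐ[volume.restrict (Ioi 0)] fun x => a * expNeg x) :
    v =ᵐ[volume] glue f a := by
  have h3 := (ae_restrict_iff' measurableSet_Ioi).1 h1
  have h4 := ae_comp_neg ((ae_restrict_iff' measurableSet_Ioi).1 h2)
  filter_upwards [h3, h4, ae_comp_neg (reflect_ae_eq v), ae_ne_zero] with x e1 e2 e3 hx
  rcases lt_or_gt_of_ne hx with hx | hx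
  · rw [glue_of_neg _ _ hx, ← neg_neg x, ← e3, e2 (mem_Ioi.2 (by linarith)), neg_neg,
      ← expPos_neg, neg_neg]
  · rw [glue_of_pos _ _ hx, e1 hx]

theorem eq_zero_of_ae_eq_glue_zero {f : ℝ → ℂ} {a : ℂ} (hf : ContinuousOn f (Ioi 0))
    (h : (0 : L2) =ᵐ[volume] glue f a) : (∀ x, 0 < x → f x = 0) ∧ a = 0 := by
  have h0 := Lp.coeFn_zero ℂ 2 (volume : Measure ℝ)
  have h1 : EqOn f (fun _ => 0) (Ioi 0) := by
    refine Measure.eqOn_open_of_ae_eq (μ := volume) ?_ isOpen_Ioi hf continuousOn_const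
    filter_upwards [ae_restrict_Ioi_of_ae_eq_glue h, ae_restrict_of_ae h0] with x e1 e2
    rw [← e1, e2, Pi.zero_apply]
  have h2 : EqOn (fun x => a * expNeg x) (fun _ => 0) (Ioi 0) := by
    refine Measure.eqOn_open_of_ae_eq (μ := volume) ?_ isOpen_Ioi
      (continuous_const.mul continuous_expNeg).continuousOn continuousOn_const
    filter_upwards [reflect_ae_restrict_Ioi_of_ae_eq_glue h, ae_restrict_of_ae h0] with x e1 e2
    rw [← e1, map_zero, e2, Pi.zero_apply]
  refine ⟨fun x hx => h1 hx, ?_⟩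
  have h3 : a * expNeg 1 = 0 := h2 (mem_Ioi.2 one_pos)
  simpa [expNeg] using h3

theorem linearIndependent_peakon : LinearIndependent ℂ ![peakonL2, peakonDerivL2] := by
  rw [LinearIndependent.pair_iff]
  intro a c h
  have e := combination_ae_eq a c
  rw [h] at e
  obtain ⟨h1, h2⟩ := eq_zero_of_ae_eq_glue_zero
    (continuous_const.mul continuous_expNeg).continuousOn e
  have h3 : a - c = 0 := by simpa [expNeg] using h1 1 one_pos
  constructor
  · linear_combination (h2 + h3) / 2
  · linear_combination (h2 - h3) / 2

theorem mem_span_of_ae_eq {v : L2} {a c : ℂ}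
    (h1 : v =ᵐ[volume.restrict (Ioi 0)] fun x => c * expNeg x)
    (h2 : reflect v =ᵐ[volume.restrict (Ioi 0)] fun x => a * expNeg x) :
    v ∈ Submodule.span ℂ {peakonL2, peakonDerivL2} := by
  rw [Submodule.mem_span_pair]
  refine ⟨(a + c) / 2, (a - c) / 2, Lp.ext ?_⟩
  refine (combination_ae_eq _ _).trans (EventuallyEq.symm ?_)
  convert! ae_eq_glue_of_ae_restrict h1 h2 using 2
  · ext x; ring
  · ring

/-- The image of the span of the profile and its derivative under the linearized operator. -/
theorem isImage_combination (b : ℝ) (a c : ℂ) : IsImage b (a • peakonL2 + c • peakonDerivL2)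
    (((2 - b) * a : ℂ) • peakonDerivL2) := by
  have hp : ∀ x, 0 < x → primitive (fun x => (a - c) * expNeg x) x
      = (a - c) * (1 - expNeg x) := fun x hx => by
    simpa using primitive_add_expNeg memLp_expNeg 0 (a - c) hx
  have ht : ∀ x, 0 ≤ x → tail (fun x => (a - c) * expNeg x) x
      = (a - c) * (expNeg x ^ 3 / 3) := fun x hx => by
    simpa using tail_add_expNeg memLp_expNeg 0 (a - c) hx
  have hL : MemLp (fun x => (1 - expNeg x) * (-((a - c) * expNeg x))) 2
      (volume.restrict (Ioi 0)) := by
    refine ((memLp_expNeg.const_mul (-(a - c))).sub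
      ((memLp_expNeg_mul memLp_expNeg).const_mul (-(a - c)))).ae_eq
      (Eventually.of_forall fun x => ?_)
    simp only [Pi.sub_apply]
    ring
  -- The constant κ is read off from the coefficient of e^{-x} in the half-line equation; the
  -- coefficients of e^{-2x} agree for every b.
  refine isImage_glue (z := 0) (κ := (1 - b / 2) * (a - c)) (a := a + c)
    (f := fun x => (a - c) * expNeg x) (f₁ := fun x => -((a - c) * expNeg x))
    (fun x _ => ((hasDerivAt_expNeg x).const_mul (a - c)).congr_deriv (by ring))
    (fun x hx => ?_) hL ?_ (combination_ae_eq a c) ?_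
  · rw [hp x hx, ht x hx.le]
    linear_combination -(b - 2) / 2 * (a - c) * expNeg x ^ 2 * expNeg_mul_expPos x
  · have h1 : Continuous fun x => (1 - expNeg x) * ((a - c) * expNeg x) := by
      have := continuous_expNeg
      fun_prop
    have h2 := h1.tendsto 0
    simp only [expNeg, neg_zero, Real.exp_zero, Complex.ofReal_one, sub_self, zero_mul] at h2
    exact h2.mono_left nhdsWithin_le_nhds
  · have e := combination_ae_eq 0 ((2 - b) * a : ℂ)
    rw [zero_smul, zero_add] at e
    convert! e using 2
    · ext x; ring
    · rw [ht 0 le_rfl]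
      simp [expNeg]
      ring

/-- If `L v - z v` is in the span of the profile and its derivative, then so is `v`, unless `z`
lies in a punctured strip. -/
theorem IsImage.mem_span {b : ℝ} {z : ℂ} {v u : L2} (h : IsImage b v u)
    (hu : u - z • v ∈ Submodule.span ℂ {peakonL2, peakonDerivL2})
    (hz : ¬(0 < |z.re| ∧ |z.re| < 5 / 2 - b)) :
    v ∈ Submodule.span ℂ {peakonL2, peakonDerivL2} := by
  rw [Submodule.mem_span_pair] at hu
  obtain ⟨a, c, hac⟩ := hu
  have e := combination_ae_eq a c
  rw [hac] at e
  have e1 := ae_restrict_Ioi_of_ae_eq_glue e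
  have e2 := reflect_ae_restrict_Ioi_of_ae_eq_glue e
  have s1 := (Lp.coeFn_sub u (z • v)).and (Lp.coeFn_smul z v)
  have hr := h.ae_eq_expNeg_or_re_bounds (z := z) (η := a - c) (by
    filter_upwards [e1, ae_restrict_of_ae s1] with x h1 h2
    rw [h2.1, Pi.sub_apply, h2.2, Pi.smul_apply, smul_eq_mul] at h1
    linear_combination h1)
  -- The left half-line, reflected, excludes the part of the strip with Re z > 0.
  have hl := h.reflect.ae_eq_expNeg_or_re_bounds (z := -z) (η := -(a + c)) (by
    filter_upwards [e2, ae_restrict_of_ae (ae_comp_neg s1),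
      ae_restrict_of_ae (reflect_ae_eq (u - z • v)), ae_restrict_of_ae (reflect_ae_eq v),
      ae_restrict_of_ae (reflect_ae_eq u), ae_restrict_of_ae (Lp.coeFn_neg (Peakon.reflect u))]
      with x h1 h2 h3 h4 h5 h6
    rw [h3, h2.1, Pi.sub_apply, h2.2, Pi.smul_apply, smul_eq_mul] at h1
    rw [h6, Pi.neg_apply, h4, h5]
    linear_combination -h1)
  rcases hr with ⟨p, hp⟩ | hr
  · rcases hl with ⟨q, hq⟩ | hl
    · exact mem_span_of_ae_eq hp hq
    · rw [Complex.neg_re] at hl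
      have : 0 < z.re := by linarith
      exact absurd ⟨by rwa [abs_of_pos this], by rw [abs_of_pos this]; linarith⟩ hz
  · exact absurd ⟨abs_pos.2 hr.1.ne, by rw [abs_of_neg hr.1]; exact hr.2⟩ hz

/-! ### Eigenfunctions in the strip -/

theorem exists_eigenvector_of_re_neg {b : ℝ} {z : ℂ} (hz : z.re < 0) (hb : -z.re < 5 / 2 - b) :
    ∃ v : L2, v ≠ 0 ∧ IsImage b v (z • v) := by
  obtain ⟨f, f₁, κ, hf, heq, hL, hL₁, h0, hne⟩ := exists_halfLine_solution hz hb
  have hfc : ContinuousOn f (Ioi 0) := fun x hx => (hf x hx).continuousAt.continuousWithinAt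
  -- The unknowns are the weights of f and e^{-x} on the right and of eˣ on the left. The rows are
  -- the coefficients, up to sign, of e^{-x} on the right and eˣ on the left in LV - zV; three
  -- unknowns against two equations leave a nonzero kernel vector.
  let T : (Fin 3 → ℂ) →ₗ[ℂ] (Fin 2 → ℂ) := Matrix.mulVecLin
    !![κ, 1 + z - b / 2, -((b - 2) / 2 : ℂ);
      3 * (b - 2) / 2 * tail f 0, (b - 2) / 2, -(1 - z - b / 2)]
  obtain ⟨w, hw, hw0⟩ := Submodule.exists_mem_ne_zero_of_ne_bot
    (LinearMap.ker_ne_bot_of_finrank_lt (f := T) (by simp))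
  have hw1 : κ * w 0 + (1 + z - b / 2) * w 1 = (b - 2) / 2 * w 2 := by
    have := congrFun (LinearMap.mem_ker.1 hw) 0
    simp [T, Matrix.mulVec, dotProduct, Fin.sum_univ_three] at this
    linear_combination this
  have hw2 : 3 * (b - 2) / 2 * (tail f 0 * w 0) + (b - 2) / 2 * w 1
      = (1 - z - b / 2) * w 2 := by
    have := congrFun (LinearMap.mem_ker.1 hw) 1
    simp [T, Matrix.mulVec, dotProduct, Fin.sum_univ_three] at this
    linear_combination this
  let F : ℝ → ℂ := fun x => w 0 * f x + w 1 * expNeg x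
  have hFL : MemLp F 2 (volume.restrict (Ioi 0)) :=
    (hL.const_mul (w 0)).add (memLp_expNeg.const_mul (w 1))
  have hFc : ContinuousOn F (Ioi 0) :=
    (continuousOn_const.mul hfc).add (continuous_const.mul continuous_expNeg).continuousOn
  have hV := (memLp_glue hFL (w 2)).coeFn_toLp
  set V : L2 := (memLp_glue hFL (w 2)).toLp _
  refine ⟨V, fun hV0 => hw0 ?_, ?_⟩
  · rw [hV0] at hV
    obtain ⟨hF0, h2⟩ := eq_zero_of_ae_eq_glue_zero hFc hV
    -- Otherwise f would be a multiple of e^{-x}.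
    have hw00 : w 0 = 0 := by
      by_contra h
      obtain ⟨x, hx, hxne⟩ := hne (-(w 1 / w 0))
      refine hxne ?_
      have := hF0 x hx
      simp only [F] at this
      field_simp
      linear_combination this
    have h1 : w 1 = 0 := by simpa [F, hw00, expNeg] using hF0 1 one_pos
    ext i
    fin_cases i
    · exact hw00
    · exact h1
    · exact h2
  · have ht0 : tail F 0 = w 0 * tail f 0 + w 1 * (1 / 3) := by
      have h := tail_add_expNeg hL (w 0) (w 1) (le_refl (0 : ℝ))
      rwa [show expNeg 0 = 1 by simp [expNeg], one_pow] at h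
    -- The function e^{-x} solves the half-line equation with constant 1 + z - b/2, and constants
    -- add linearly.
    refine isImage_glue (z := z) (κ := κ * w 0 + (1 + z - b / 2) * w 1) (f := F)
      (f₁ := fun x => w 0 * f₁ x + w 1 * -expNeg x)
      (fun x hx => ((hf x hx).const_mul _).fun_add ((hasDerivAt_expNeg x).const_mul _))
      (fun x hx => ?_) ?_ ?_ hV ?_
    · rw [primitive_add_expNeg hL _ _ hx, tail_add_expNeg hL _ _ hx.le]
      simp only [F]
      linear_combination w 0 * heq x hx
        - (b - 2) / 2 * w 1 * expNeg x ^ 2 * expNeg_mul_expPos x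
    · refine ((hL₁.const_mul (w 0)).sub ((memLp_expNeg.const_mul (w 1)).sub
        ((memLp_expNeg_mul memLp_expNeg).const_mul (w 1)))).ae_eq
        (Eventually.of_forall fun x => ?_)
      simp only [Pi.sub_apply]
      ring
    · have h1 : Continuous fun x => (1 - expNeg x) * (w 1 * expNeg x) := by
        have := continuous_expNeg
        fun_prop
      have h2 := h1.tendsto 0
      simp only [expNeg, neg_zero, Real.exp_zero, Complex.ofReal_one, sub_self, zero_mul] at h2
      have h3 := (h0.const_mul (w 0)).add (h2.mono_left (nhdsWithin_le_nhds (s := Ioi 0)))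
      rw [mul_zero, zero_add] at h3
      refine h3.congr fun x => ?_
      simp only [F, expNeg]
      ring
    · filter_upwards [hV, Lp.coeFn_smul z V, ae_ne_zero] with x e1 e2 hx
      rw [e2, Pi.smul_apply, e1, smul_eq_mul]
      rcases lt_or_gt_of_ne hx with hx | hx
      · rw [glue_of_neg _ _ hx, glue_of_neg _ _ hx, ht0]
        linear_combination expPos x * hw2
      · rw [glue_of_pos _ _ hx, glue_of_pos _ _ hx, hw1]
        ring

theorem reflect_ne_zero {v : L2} (h : v ≠ 0) : reflect v ≠ 0 := by
  rw [← norm_ne_zero_iff, reflect, Lp.norm_compMeasurePreserving]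
  exact norm_ne_zero_iff.2 h

theorem exists_eigenvector {b : ℝ} {z : ℂ} (hz : 0 < |z.re|) (hb : |z.re| < 5 / 2 - b) :
    ∃ v : L2, v ≠ 0 ∧ IsImage b v (z • v) := by
  rcases lt_or_gt_of_ne (abs_pos.1 hz) with h | h
  · rw [abs_of_neg h] at hb
    exact exists_eigenvector_of_re_neg h hb
  · rw [abs_of_pos h] at hb
    obtain ⟨v, hv, hi⟩ := exists_eigenvector_of_re_neg (b := b) (z := -z) (by simpa using h)
      (by simpa using hb)
    refine ⟨reflect v, reflect_ne_zero hv, ?_⟩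
    have e : -reflect (-z • v) = z • reflect v := by
      refine Lp.ext ?_
      filter_upwards [Lp.coeFn_neg (reflect (-z • v)), reflect_ae_eq (-z • v), reflect_ae_eq v,
        ae_comp_neg (Lp.coeFn_smul (-z) v), Lp.coeFn_smul z (reflect v)] with x h1 h2 h3 h4 h5
      rw [h1, Pi.neg_apply, h2, h4, h5, Pi.smul_apply, Pi.smul_apply, h3, neg_smul, neg_neg]
    rw [← e]
    exact hi.reflect

/-! ### The point spectrum and the root space -/

theorem shift_linOp_ne_bot_iff {b : ℝ} {z : ℂ} :
    LinearMap.ker (shift (linOp b) z) ≠ ⊥ ↔ ∃ v : L2, v ≠ 0 ∧ IsImage b v (z • v) := by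
  rw [Submodule.ne_bot_iff]
  constructor
  · rintro ⟨v, hv, hv0⟩
    refine ⟨v, fun h => hv0 (Subtype.ext h), ?_⟩
    have h : linMap b v - z • (v : L2) = 0 := hv
    rw [← sub_eq_zero.1 h]
    exact isImage_linMap b v
  · rintro ⟨v, hv0, hi⟩
    refine ⟨⟨v, hi.mem_dom⟩, ?_, fun h => hv0 (congrArg Subtype.val h)⟩
    have h : linMap b ⟨v, hi.mem_dom⟩ - z • v = 0 := by rw [hi.linMap_eq, sub_self]
    exact h

/-- A nonzero kernel already excludes z from the resolvent set, so membership in the spectrum is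
automatic. -/
theorem mem_pointSpectrum_linOp_iff {b : ℝ} {z : ℂ} :
    z ∈ pointSpectrum (linOp b) ↔ ∃ v : L2, v ≠ 0 ∧ IsImage b v (z • v) := by
  rw [← shift_linOp_ne_bot_iff]
  exact ⟨fun h => h.2, fun h => ⟨fun hr => h hr.1, h⟩⟩

theorem pointSpectrum_linOp (b : ℝ) :
    pointSpectrum (linOp b) = {0} ∪ {z : ℂ | 0 < |z.re| ∧ |z.re| < 5 / 2 - b} := by
  ext z
  rw [mem_pointSpectrum_linOp_iff]
  have hind := LinearIndependent.pair_iff.1 linearIndependent_peakon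
  constructor
  · rintro ⟨v, hv0, hv⟩
    by_cases hz : 0 < |z.re| ∧ |z.re| < 5 / 2 - b
    · exact Or.inr hz
    · left
      have hs := hv.mem_span (z := z) (by rw [sub_self]; exact Submodule.zero_mem _) hz
      rw [Submodule.mem_span_pair] at hs
      obtain ⟨a, c, rfl⟩ := hs
      have e := (hv.linMap_eq hv.mem_dom).symm.trans
        ((isImage_combination b a c).linMap_eq hv.mem_dom)
      -- Compare coefficients in z(aφ + cφ') = (2-b)aφ'. The system is triangular with diagonal z,
      -- so z ≠ 0 would force a = c = 0.
      obtain ⟨h1, h2⟩ := hind (z * a) (z * c - (2 - b) * a) (by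
        rw [sub_smul, ← e]
        module)
      by_contra hz0
      have hz0 : z ≠ 0 := hz0
      have ha : a = 0 := (mul_eq_zero.1 h1).resolve_left hz0
      have hc : c = 0 := by
        rw [ha, mul_zero, sub_zero] at h2
        exact (mul_eq_zero.1 h2).resolve_left hz0
      exact hv0 (by rw [ha, hc, zero_smul, zero_smul, zero_add])
  · rintro (hz | ⟨h1, h2⟩)
    · rw [mem_singleton_iff.1 hz]
      refine ⟨peakonDerivL2, fun h => ?_, ?_⟩
      · exact one_ne_zero (hind 0 1 (by rw [h, smul_zero, add_zero, zero_smul])).2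
      · simpa using isImage_combination b 0 1
    · exact exists_eigenvector h1 h2

theorem mem_powKer_succ_iff {b : ℝ} {n : ℕ} {v : L2} :
    v ∈ powKer (linOp b) 0 (n + 1) ↔ ∃ u ∈ powKer (linOp b) 0 n, IsImage b v u := by
  constructor
  · rintro ⟨w, hw, rfl⟩
    have h : linMap b w - (0 : ℂ) • (w : L2) ∈ powKer (linOp b) 0 n := hw
    rw [zero_smul, sub_zero] at h
    exact ⟨_, h, isImage_linMap b w⟩
  · rintro ⟨u, hu, hi⟩
    refine ⟨⟨v, hi.mem_dom⟩, ?_, rfl⟩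
    have h : linMap b ⟨v, hi.mem_dom⟩ - (0 : ℂ) • v ∈ powKer (linOp b) 0 n := by
      rwa [hi.linMap_eq, zero_smul, sub_zero]
    exact h

/-- Since z = 0 is outside the punctured strip for every b, L maps a vector into the span only if
the vector is already there; induction gives one inclusion. The other holds because Lφ' = 0 and Lφ
is a multiple of φ'. -/
theorem genEigenspace_linOp (b : ℝ) :
    genEigenspace (linOp b) 0 = Submodule.span ℂ {peakonL2, peakonDerivL2} := by
  apply le_antisymm
  · refine iSup_le fun n => ?_
    induction n with
    | zero => exact bot_le
    | succ n ih =>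
      intro v hv
      obtain ⟨u, hu, hi⟩ := mem_powKer_succ_iff.1 hv
      exact hi.mem_span (z := 0) (by rw [zero_smul, sub_zero]; exact ih hu) (by simp)
  · have h1 : ∀ c : ℂ, c • peakonDerivL2 ∈ powKer (linOp b) 0 1 := fun c =>
      mem_powKer_succ_iff.2 ⟨0, Submodule.zero_mem _, by simpa using isImage_combination b 0 c⟩
    have h2 : peakonL2 ∈ powKer (linOp b) 0 2 :=
      mem_powKer_succ_iff.2 ⟨_, h1 _, by simpa using isImage_combination b 1 0⟩
    rw [Submodule.span_le]
    rintro v (rfl | hv)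
    · exact le_iSup (powKer (linOp b) 0) 2 h2
    · rw [mem_singleton_iff.1 hv]
      exact le_iSup (powKer (linOp b) 0) 1 (by simpa using h1 1)

theorem finrank_genEigenspace_linOp (b : ℝ) :
    Module.finrank ℂ (genEigenspace (linOp b) 0) = 2 := by
  rw [genEigenspace_linOp]
  have h := finrank_span_eq_card linearIndependent_peakon
  rwa [Matrix.range_cons, Matrix.range_cons, Matrix.range_empty, union_empty, singleton_union,
    Fintype.card_fin] at h

end Peakon

end

theorem lemma3p2 (b : ℝ) :
    Peakon.pointSpectrum (Peakon.linOp b) =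
        {0} ∪ {z : ℂ | 0 < |z.re| ∧ |z.re| < 5 / 2 - b} ∧
      Peakon.genEigenspace (Peakon.linOp b) 0 =
        Submodule.span ℂ {Peakon.peakonL2, Peakon.peakonDerivL2} ∧
      Module.finrank ℂ (Peakon.genEigenspace (Peakon.linOp b) 0) = 2 :=
  ⟨Peakon.pointSpectrum_linOp b, Peakon.genEigenspace_linOp b,
    Peakon.finrank_genEigenspace_linOp b⟩
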